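/- For $\gamma>1$ and $b>0$ consider the self-similar problem for a differentiable function $\Phi:(0,\infty)\to\mathbb R$: $$b\,x\,\Phi'(x)=\Phi(x)-2^{\gamma-1}\bigl(\Phi(x/2)\bigr)^2+\bigl(\Phi(x)\bigr)^2\quad\text{for all }x>0,\qquad \Phi(x)\sim x^{1/b}\ \text{ as }x\to0^+,$$ where $\Phi(x)\sim x^{1/b}$ means $\lim_{x\to0^+}x^{-1/b}\,\Phi(x)=1$. There exist $\bar\gamma>1$ and a function $\gamma\mapsto\bar b(\gamma)>0$, defined for $\gamma>\bar\gamma$, such that for every $\gamma>\bar\gamma$ the self-similar problem with $b=\bar b(\gamma)$ has a solution $\Phi$ that is positive, i.e. $\Phi(x)>0$ for all $x>0$, and decays exponentially, i.e. there are constants $C,c>0$ (depending on $\gamma$) with $|\Phi(x)|\le C e^{-cx}$ for all sufficiently large $x$. Moreover, $\bar b(\gamma)\to1$ as $\gamma\to\infty$. -/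

import Mathlib

open Filter Topology Asymptotics

/-- `Φ` solves the self-similar problem with homogeneity `γ` and parameter `b`: on `(0, ∞)` it is
differentiable with `b x Φ'(x) = Φ(x) - 2^(γ-1) Φ(x/2)² + Φ(x)²`, and `Φ(x) ∼ x^(1/b)` as
`x → 0⁺`. The values of `Φ` outside `(0, ∞)` play no role. -/
structure IsSelfSimilarProfile (γ b : ℝ) (Φ : ℝ → ℝ) : Prop where
  differentiableAt : ∀ x : ℝ, 0 < x → DifferentiableAt ℝ Φ x
  equation : ∀ x : ℝ, 0 < x →
    b * x * deriv Φ x = Φ x - (2 : ℝ) ^ (γ - 1) * (Φ (x / 2)) ^ 2 + (Φ x) ^ 2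
  isEquivalent_zero : Φ ~[𝓝[>] 0] fun x : ℝ => x ^ (1 / b)

/-- `Φ` decays exponentially at infinity: `|Φ(x)| ≤ C e^(-cx)` for all sufficiently large `x`, for
some constants `C, c > 0`. -/
def HasExponentialDecay (Φ : ℝ → ℝ) : Prop :=
  ∃ C c : ℝ, 0 < C ∧ 0 < c ∧ ∀ᶠ x : ℝ in atTop, |Φ x| ≤ C * Real.exp (-c * x)

/-!
Write `b = log 2 / (-log θ)`, so that `2 ^ (1 / b) = θ⁻¹`, and put `Φ(x) = y u(k y)` with
`y = x ^ (1 / b)` and `k = 2 ^ (γ - 1) θ ^ 2`. The self-similar problem becomes the regular delay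
equation
  `u'(z) = δ u(z)² - u(θ z)²`, `u(0) = 1`, with `δ = 1 / k`.
Large `γ` means small `δ`, and for `δ = 0`, `θ = 1/2` the solution is `e^{-z}`. A positive
exponentially decaying solution for small `δ > 0` is found by shooting in `θ` near `1/2`.

The nonlinearity is clipped to the region `0 ≤ u(z) ≤ 2 / (1 + z)²`, which makes the equation
globally solvable (`exists_isClippedSolution`, a contraction in an exponentially weighted supremum
norm), with Lipschitz dependence on `θ` and `δ` (`IsClippedSolution.abs_sub_le_of_parameters`).
Leaving the region is irreversible on both sides: a negative solution stays negative
(`IsClippedSolution.neg_of_neg`), and one that is above the barrier at some `z ≥ 40` stays above it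
(`IsClippedSolution.barrier_le_of_barrier_le`). Hence the parameters for which the solution leaves
downwards and those for which it leaves upwards form disjoint relatively open sets; if both are
non-empty, connectedness of an interval of `θ` gives a solution that never leaves, for which the
clipping is inactive. Such a solution decays exponentially in `x` (`IsDecayingProfile.mul_le`):
a bound `u ≤ a / z` on `[Z, ∞)` improves to `u ≤ a² θ⁻² / z` on `[Z / θ, ∞)`, and iterating gives
`z u(z) ≤ θ² 2^(-2^n)` for `z ≥ 40 θ⁻ⁿ`, that is, for `x` at least a constant times `2ⁿ`.

Both sets are non-empty because for `δ = 0` the two sides of `θ = 1/2` behave in opposite ways. The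
hazard rate `r(z) = -u'(z) / u(z) = u(θ z)² / u(z)` satisfies `r' = r (r(z) - 2 θ r(θ z))` and
`r(0) = 1`. If `θ < 1/2` it is increasing with `r' ≥ (1 - 2 θ) r²`, so it blows up and `u` reaches
zero (`IsClippedSolution.exists_neg_of_lt_half`). If `θ > 1/2` it is decreasing and is at most
`1 / (1 + (2 θ - 1) z)`, so `u` has an algebraic lower bound, which is incompatible with staying in
the region (`IsClippedSolution.exists_barrier_lt_of_half_lt`). Each fixed pair `θ = 1/2 ± ρ` keeps
this behaviour for all sufficiently small `δ`. As `ρ` is arbitrary, `θ → 1/2` and `b → 1` as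
`γ → ∞`.
-/

/-! ### The clipped delay equation -/

/-- The upper barrier `2 / (1 + |z|)²`. It lies above `e^{-z}` on `[0, ∞)`, and it decays faster than
the algebraic tail `const / z` of those solutions of the delay equation that fail to decay
exponentially. -/
noncomputable def barrier (z : ℝ) : ℝ := 2 / (1 + |z|) ^ 2

/-- The value `a` truncated to the interval `[0, barrier z]`. -/
noncomputable def clip (z a : ℝ) : ℝ := max 0 (min a (barrier z))

/-- The right-hand side `δ u(z)² - u(θ z)²` of the delay equation, with the values of `u` clipped;
it is bounded and globally Lipschitz in `u`. -/
noncomputable def clippedRHS (θ δ : ℝ) (u : ℝ → ℝ) (z : ℝ) : ℝ :=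
  δ * clip z (u z) ^ 2 - clip (θ * z) (u (θ * z)) ^ 2

/-- `u` solves the clipped delay equation with ratio `θ` and parameter `δ` on `[0, ∞)`, with
`u 0 = 1`. The derivative at `0` is two-sided; the values on `(-∞, 0)` are otherwise arbitrary. -/
structure IsClippedSolution (θ δ : ℝ) (u : ℝ → ℝ) : Prop where
  zero : u 0 = 1
  hasDerivAt : ∀ z : ℝ, 0 ≤ z → HasDerivAt u (clippedRHS θ δ u z) z

lemma barrier_pos (z : ℝ) : 0 < barrier z := by unfold barrier; positivity

lemma barrier_le_two (z : ℝ) : barrier z ≤ 2 := by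
  unfold barrier
  rw [div_le_iff₀ (by positivity)]
  nlinarith [abs_nonneg z]

lemma continuous_barrier : Continuous barrier := by
  unfold barrier
  refine continuous_const.div (by fun_prop) fun z => by positivity

lemma abs_barrier_sub_le (z w : ℝ) : |barrier z - barrier w| ≤ 4 * |z - w| := by
  have key : ∀ a b : ℝ, 0 ≤ a → 0 ≤ b → a ≤ b →
      2 / (1 + a) ^ 2 - 2 / (1 + b) ^ 2 ≤ 4 * (b - a) := by
    intro a b ha hb hab
    have h1 : 2 / (1 + a) ^ 2 - 2 / (1 + b) ^ 2 =
        2 * (b - a) * ((1 / (1 + a)) * (1 / (1 + b))) * (1 / (1 + a) + 1 / (1 + b)) := by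
      field_simp
      ring
    have h2 : 1 / (1 + a) ≤ 1 := by rw [div_le_one (by positivity)]; linarith
    have h3 : 1 / (1 + b) ≤ 1 := by rw [div_le_one (by positivity)]; linarith
    have h4 : (1 / (1 + a)) * (1 / (1 + b)) ≤ 1 := mul_le_one₀ h2 (by positivity) h3
    rw [h1]
    calc _ ≤ 2 * (b - a) * 1 * (1 + 1) := by gcongr
      _ = _ := by ring
  have anti : ∀ a b : ℝ, 0 ≤ a → a ≤ b → 2 / (1 + b) ^ 2 ≤ 2 / (1 + a) ^ 2 := by
    intro a b ha hab
    gcongr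
  have h5 := abs_abs_sub_abs_le z w
  unfold barrier
  rcases le_total |z| |w| with h | h
  · rw [abs_of_nonneg (by linarith [anti _ _ (abs_nonneg z) h])]
    have := key _ _ (abs_nonneg z) (abs_nonneg w) h
    have : |w| - |z| ≤ |z - w| := by
      rw [abs_sub_comm] at h5 ⊢; exact (le_abs_self _).trans (abs_abs_sub_abs_le w z)
    linarith
  · rw [abs_sub_comm, abs_of_nonneg (by linarith [anti _ _ (abs_nonneg w) h])]
    have := key _ _ (abs_nonneg w) (abs_nonneg z) h
    have : |z| - |w| ≤ |z - w| := (le_abs_self _).trans h5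
    linarith

lemma clip_nonneg (z a : ℝ) : 0 ≤ clip z a := le_max_left _ _

lemma clip_le_barrier (z a : ℝ) : clip z a ≤ barrier z :=
  max_le (barrier_pos z).le (min_le_right _ _)

lemma clip_le_two (z a : ℝ) : clip z a ≤ 2 := (clip_le_barrier z a).trans (barrier_le_two z)

lemma clip_of_nonpos {z a : ℝ} (h : a ≤ 0) : clip z a = 0 :=
  max_eq_left ((min_le_left _ _).trans h)

lemma clip_of_mem {z a : ℝ} (h₀ : 0 ≤ a) (h₁ : a ≤ barrier z) : clip z a = a := by
  rw [clip, min_eq_left h₁, max_eq_right h₀]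

lemma abs_clip_sub_le (z w a b : ℝ) : |clip z a - clip w b| ≤ |a - b| + 4 * |z - w| := by
  unfold clip
  have h := abs_barrier_sub_le z w
  refine (abs_max_sub_max_le_max _ _ _ _).trans (max_le ?_ ?_)
  · rw [sub_self, abs_zero]
    positivity
  · refine (abs_min_sub_min_le_max _ _ _ _).trans (max_le ?_ ?_)
    · linarith [abs_nonneg (z - w)]
    · linarith [abs_nonneg (a - b)]

lemma abs_clip_sq_sub_le (z w a b : ℝ) :
    |clip z a ^ 2 - clip w b ^ 2| ≤ 4 * (|a - b| + 4 * |z - w|) := by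
  rw [sq_sub_sq, abs_mul]
  have h : |clip z a + clip w b| ≤ 4 := by
    rw [abs_of_nonneg (add_nonneg (clip_nonneg _ _) (clip_nonneg _ _))]
    linarith [clip_le_two z a, clip_le_two w b]
  exact mul_le_mul h (abs_clip_sub_le _ _ _ _) (abs_nonneg _) (by norm_num)

lemma clip_sq_le_four (z a : ℝ) : clip z a ^ 2 ≤ 4 := by
  nlinarith [clip_nonneg z a, clip_le_two z a]

lemma continuous_clippedRHS {u : ℝ → ℝ} (hu : Continuous u) (θ δ : ℝ) :
    Continuous (clippedRHS θ δ u) := by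
  unfold clippedRHS clip
  have := continuous_barrier
  fun_prop

lemma abs_clippedRHS_le {δ : ℝ} (h₀ : 0 ≤ δ) (h₁ : δ ≤ 1) (θ : ℝ) (u : ℝ → ℝ) (z : ℝ) :
    |clippedRHS θ δ u z| ≤ 4 := by
  unfold clippedRHS
  have h2 := clip_sq_le_four z (u z)
  have h3 := clip_sq_le_four (θ * z) (u (θ * z))
  have h4 := sq_nonneg (clip z (u z))
  have h5 := sq_nonneg (clip (θ * z) (u (θ * z)))
  have h6 : δ * clip z (u z) ^ 2 ≤ 1 * 4 := by gcongr
  have h7 : 0 ≤ δ * clip z (u z) ^ 2 := by positivity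
  rw [abs_le]; constructor <;> linarith

/-- Global existence, by a contraction for the weighted unknown `e^{-16 |z|} u(z)`. Working with even
functions of `z` keeps the fixed-point problem on all of `ℝ`. -/
lemma exists_isClippedSolution {θ δ : ℝ} (hθ₀ : 0 ≤ θ) (hθ₁ : θ ≤ 1) (hδ₀ : 0 ≤ δ) (hδ₁ : δ ≤ 1) :
    ∃ u, IsClippedSolution θ δ u := by
  classical
  let up : BoundedContinuousFunction ℝ ℝ → ℝ → ℝ := fun v z => Real.exp (16 * |z|) * v z
  have hup : ∀ v, Continuous (up v) := fun v => by
    have := v.continuous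
    fun_prop
  -- the right-hand side of the integral equation; it is differentiable also at `0`
  let I : BoundedContinuousFunction ℝ ℝ → ℝ → ℝ := fun v y =>
    1 + ∫ s in (0:ℝ)..y, clippedRHS θ δ (up v) s
  have hId : ∀ v y, HasDerivAt (I v) (clippedRHS θ δ (up v) y) y := fun v y =>
    ((continuous_clippedRHS (hup v) θ δ).integral_hasStrictDerivAt 0 y).hasDerivAt.const_add 1
  have hIc : ∀ v, Continuous (I v) := fun v =>
    continuous_iff_continuousAt.2 fun y => (hId v y).continuousAt
  have hIb : ∀ v, ∀ y, 0 ≤ y → |I v y| ≤ 1 + 4 * y := by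
    intro v y hy
    have h1 : ‖∫ s in (0:ℝ)..y, clippedRHS θ δ (up v) s‖ ≤ 4 * |y - 0| :=
      intervalIntegral.norm_integral_le_of_norm_le_const fun s _ => abs_clippedRHS_le hδ₀ hδ₁ _ _ _
    rw [sub_zero, abs_of_nonneg hy, Real.norm_eq_abs] at h1
    calc _ ≤ |(1:ℝ)| + _ := abs_add_le _ _
      _ ≤ _ := by rw [abs_one]; linarith
  let T : BoundedContinuousFunction ℝ ℝ → BoundedContinuousFunction ℝ ℝ := fun v =>
    BoundedContinuousFunction.ofNormedAddCommGroup
      (fun z => Real.exp (-(16 * |z|)) * I v |z|)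
      (by have := hIc v; fun_prop) 1 (by
        intro z
        rw [norm_mul, Real.norm_eq_abs, Real.norm_eq_abs, abs_of_pos (Real.exp_pos _), Real.exp_neg,
          inv_mul_le_iff₀ (Real.exp_pos _), mul_one]
        refine (hIb v _ (abs_nonneg z)).trans ?_
        linarith [Real.add_one_le_exp (16 * |z|), abs_nonneg z])
  have hT : ContractingWith (1/2) T := by
    refine ⟨by rw [← NNReal.coe_lt_coe]; norm_num, LipschitzWith.of_dist_le_mul fun v w => ?_⟩
    refine (BoundedContinuousFunction.dist_le (by positivity)).2 fun z => ?_
    set d := dist v w with hd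
    have hd0 : 0 ≤ d := dist_nonneg
    have hvw : ∀ s, |up v s - up w s| ≤ Real.exp (16 * |s|) * d := by
      intro s
      simp only [up]
      rw [← mul_sub, abs_mul, abs_of_pos (Real.exp_pos _)]
      gcongr
      exact (Real.dist_eq _ _).symm.trans_le
        (BoundedContinuousFunction.dist_coe_le_dist (f := v) (g := w) s)
    have hr : ∀ s, 0 ≤ s → |clippedRHS θ δ (up v) s - clippedRHS θ δ (up w) s| ≤
        8 * d * Real.exp (16 * s) := by
      intro s hs
      have h1 := abs_clip_sq_sub_le s s (up v s) (up w s)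
      have h2 := abs_clip_sq_sub_le (θ * s) (θ * s) (up v (θ * s)) (up w (θ * s))
      rw [sub_self, abs_zero, mul_zero, add_zero] at h1 h2
      have h3 := hvw s
      have h4 := hvw (θ * s)
      rw [abs_of_nonneg hs] at h3
      rw [abs_of_nonneg (mul_nonneg hθ₀ hs)] at h4
      have h5 : Real.exp (16 * (θ * s)) * d ≤ Real.exp (16 * s) * d := by
        gcongr
        nlinarith
      have h6 : clippedRHS θ δ (up v) s - clippedRHS θ δ (up w) s =
        δ * (clip s (up v s) ^ 2 - clip s (up w s) ^ 2) -
          (clip (θ * s) (up v (θ * s)) ^ 2 - clip (θ * s) (up w (θ * s)) ^ 2) := by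
        unfold clippedRHS; ring
      rw [h6]
      refine (abs_sub _ _).trans ?_
      rw [abs_mul, abs_of_nonneg hδ₀]
      have h7 : δ * |clip s (up v s) ^ 2 - clip s (up w s) ^ 2| ≤
          1 * |clip s (up v s) ^ 2 - clip s (up w s) ^ 2| := by gcongr
      linarith
    have hint : |I v (|z|) - I w (|z|)| ≤ d / 2 * Real.exp (16 * |z|) := by
      have hB : ∀ x : ℝ, HasDerivAt (fun s => d / 2 * Real.exp (16 * s))
          (8 * d * Real.exp (16 * x)) x := by
        intro x
        have := (((hasDerivAt_id x).const_mul 16).exp).const_mul (d / 2)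
        refine this.congr_deriv ?_
        simp only [id]
        ring
      have := image_norm_le_of_norm_deriv_right_le_deriv_boundary (a := 0) (b := |z|)
        (f := fun y => I v y - I w y)
        (f' := fun s => clippedRHS θ δ (up v) s - clippedRHS θ δ (up w) s)
        ((hIc v).sub (hIc w)).continuousOn
        (fun x _ => ((hId v x).sub (hId w x)).hasDerivWithinAt)
        (B := fun s => d / 2 * Real.exp (16 * s)) (B' := fun s => 8 * d * Real.exp (16 * s))
        (by simp [I]; positivity) hB (fun x hx => hr x hx.1)
      exact this ⟨abs_nonneg z, le_rfl⟩
    simp only [T, BoundedContinuousFunction.coe_ofNormedAddCommGroup]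
    rw [Real.dist_eq, ← mul_sub, abs_mul, abs_of_pos (Real.exp_pos _), Real.exp_neg,
      inv_mul_le_iff₀ (Real.exp_pos _)]
    push_cast
    linarith
  set v := hT.fixedPoint T
  have hv : ∀ z, v z = Real.exp (-(16 * |z|)) * I v |z| := fun z => by
    have h1 : T v = v := hT.fixedPoint_isFixedPt
    conv_lhs => rw [← h1]
    rfl
  have hI : ∀ z, 0 ≤ z → up v z = I v z := by
    intro z hz
    simp only [up]
    rw [hv z, ← mul_assoc, ← Real.exp_add, add_neg_cancel, Real.exp_zero, one_mul, abs_of_nonneg hz]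
  refine ⟨I v, by simp [I], fun z hz => ?_⟩
  have h2 : clippedRHS θ δ (I v) z = clippedRHS θ δ (up v) z := by
    unfold clippedRHS
    rw [hI z hz, hI (θ * z) (by positivity)]
  rw [h2]
  exact hId v z

/-! ### Dependence on the parameters -/

namespace IsClippedSolution

variable {θ δ : ℝ} {u : ℝ → ℝ}

lemma abs_sub_le (h : IsClippedSolution θ δ u) (hδ₀ : 0 ≤ δ) (hδ₁ : δ ≤ 1) {a b : ℝ}
    (ha : 0 ≤ a) (hb : 0 ≤ b) : |u a - u b| ≤ 4 * |a - b| := by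
  have := (convex_Ici (0:ℝ)).norm_image_sub_le_of_norm_hasDerivWithin_le (f := u)
    (f' := clippedRHS θ δ u) (C := 4) (fun z hz => (h.hasDerivAt z hz).hasDerivWithinAt)
    (fun z _ => abs_clippedRHS_le hδ₀ hδ₁ _ _ _) hb ha
  simpa using this

lemma continuousOn (h : IsClippedSolution θ δ u) : ContinuousOn u (Set.Ici 0) :=
  fun z hz => (h.hasDerivAt z hz).continuousAt.continuousWithinAt

end IsClippedSolution

/-- Clipped solutions depend Lipschitz-continuously on the two parameters, locally uniformly in
`z`; in particular they are unique on `[0, ∞)`. -/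
lemma IsClippedSolution.abs_sub_le_of_parameters {θ₁ θ₂ δ₁ δ₂ : ℝ} {u₁ u₂ : ℝ → ℝ}
    (h₁ : IsClippedSolution θ₁ δ₁ u₁) (h₂ : IsClippedSolution θ₂ δ₂ u₂)
    (hθ₁ : 0 ≤ θ₁ ∧ θ₁ ≤ 1) (hθ₂ : 0 ≤ θ₂) (hδ₁ : 0 ≤ δ₁ ∧ δ₁ ≤ 1) (hδ₂ : 0 ≤ δ₂ ∧ δ₂ ≤ 1)
    {Z z : ℝ} (hz : 0 ≤ z) (hzZ : z ≤ Z) :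
    |u₁ z - u₂ z| ≤
      Real.exp (16 * Z) * (2 * Z * (4 + 32 * Z)) * (|θ₁ - θ₂| + |δ₁ - δ₂|) := by
  have hZ : 0 ≤ Z := hz.trans hzZ
  set D := |θ₁ - θ₂| + |δ₁ - δ₂| with hD
  have hD0 : 0 ≤ D := by positivity
  -- the weighted difference attains its maximum over `[0, Z]`
  obtain ⟨t, ht, hmax⟩ := isCompact_Icc.exists_isMaxOn (s := Set.Icc 0 Z) ⟨0, le_rfl, hZ⟩
    (f := fun s => Real.exp (-(16 * s)) * |u₁ s - u₂ s|) (by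
      have c1 := h₁.continuousOn.mono (t := Set.Icc 0 Z) (fun x hx => hx.1)
      have c2 := h₂.continuousOn.mono (t := Set.Icc 0 Z) (fun x hx => hx.1)
      exact (by fun_prop : Continuous fun s : ℝ => Real.exp (-(16 * s))).continuousOn.mul
        (c1.sub c2).abs)
  set W := Real.exp (-(16 * t)) * |u₁ t - u₂ t| with hW
  have hW0 : 0 ≤ W := by positivity
  have hd : ∀ s, 0 ≤ s → s ≤ Z → |u₁ s - u₂ s| ≤ W * Real.exp (16 * s) := by
    intro s hs hsZ
    have h3 : Real.exp (-(16 * s)) * |u₁ s - u₂ s| ≤ W := hmax ⟨hs, hsZ⟩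
    rwa [Real.exp_neg, inv_mul_le_iff₀ (Real.exp_pos _), mul_comm] at h3
  have hr : ∀ s, 0 ≤ s → s ≤ Z → |clippedRHS θ₁ δ₁ u₁ s - clippedRHS θ₂ δ₂ u₂ s| ≤
      (4 + 32 * Z) * D + 8 * W * Real.exp (16 * s) := by
    intro s hs hsZ
    have e1 := abs_clip_sq_sub_le s s (u₁ s) (u₂ s)
    rw [sub_self, abs_zero, mul_zero, add_zero] at e1
    have e2 := abs_clip_sq_sub_le (θ₁ * s) (θ₂ * s) (u₁ (θ₁ * s)) (u₂ (θ₂ * s))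
    have e3 : |θ₁ * s - θ₂ * s| = |θ₁ - θ₂| * s := by rw [← sub_mul, abs_mul, abs_of_nonneg hs]
    have e4 := h₂.abs_sub_le hδ₂.1 hδ₂.2 (mul_nonneg hθ₁.1 hs) (mul_nonneg hθ₂ hs)
    have e5 := hd s hs hsZ
    have hθs : θ₁ * s ≤ s := by nlinarith [hθ₁.2]
    have e6 := hd (θ₁ * s) (mul_nonneg hθ₁.1 hs) (hθs.trans hsZ)
    have e7 : W * Real.exp (16 * (θ₁ * s)) ≤ W * Real.exp (16 * s) := by gcongr
    have e8 := _root_.abs_sub_le (u₁ (θ₁ * s)) (u₂ (θ₁ * s)) (u₂ (θ₂ * s))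
    rw [e3] at e2 e4
    have e9 : |θ₁ - θ₂| * s ≤ |θ₁ - θ₂| * Z := by gcongr
    have e10 : clippedRHS θ₁ δ₁ u₁ s - clippedRHS θ₂ δ₂ u₂ s =
        δ₁ * (clip s (u₁ s) ^ 2 - clip s (u₂ s) ^ 2) + (δ₁ - δ₂) * clip s (u₂ s) ^ 2 -
          (clip (θ₁ * s) (u₁ (θ₁ * s)) ^ 2 - clip (θ₂ * s) (u₂ (θ₂ * s)) ^ 2) := by
      unfold clippedRHS; ring
    have e11 : δ₁ * |clip s (u₁ s) ^ 2 - clip s (u₂ s) ^ 2| ≤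
        1 * |clip s (u₁ s) ^ 2 - clip s (u₂ s) ^ 2| := by gcongr; exact hδ₁.2
    have e12 : |δ₁ - δ₂| * clip s (u₂ s) ^ 2 ≤ |δ₁ - δ₂| * 4 := by
      gcongr; exact clip_sq_le_four _ _
    have e13 : |δ₁ - δ₂| * Z ≥ 0 := by positivity
    have e14 : |θ₁ - θ₂| ≥ 0 := abs_nonneg _
    rw [e10]
    refine (abs_sub _ _).trans ((add_le_add_left (abs_add_le _ _) _).trans ?_)
    rw [abs_mul, abs_mul, abs_of_nonneg hδ₁.1, abs_of_nonneg (sq_nonneg (clip s (u₂ s)))]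
    have e15 : (4 + 32 * Z) * D = 4 * |θ₁ - θ₂| + 4 * |δ₁ - δ₂| + 32 * (|θ₁ - θ₂| * Z)
      + 32 * (|δ₁ - δ₂| * Z) := by rw [hD]; ring
    linarith
  have hB : ∀ x : ℝ, HasDerivAt (fun s => (4 + 32 * Z) * D * s + W / 2 * Real.exp (16 * s))
      ((4 + 32 * Z) * D + 8 * W * Real.exp (16 * x)) x := by
    intro x
    have := ((hasDerivAt_id x).const_mul ((4 + 32 * Z) * D)).add
      ((((hasDerivAt_id x).const_mul 16).exp).const_mul (W / 2))
    refine this.congr_deriv ?_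
    simp only [id]
    ring
  have hmain := image_norm_le_of_norm_deriv_right_le_deriv_boundary (a := 0) (b := t)
    (f := fun y => u₁ y - u₂ y)
    (f' := fun s => clippedRHS θ₁ δ₁ u₁ s - clippedRHS θ₂ δ₂ u₂ s)
    ((h₁.continuousOn.sub h₂.continuousOn).mono Set.Icc_subset_Ici_self)
    (fun x hx => ((h₁.hasDerivAt x hx.1).sub (h₂.hasDerivAt x hx.1)).hasDerivWithinAt)
    (by simp [h₁.zero, h₂.zero]; positivity) hB
    (fun x hx => hr x hx.1 (hx.2.le.trans ht.2)) ⟨ht.1, le_rfl⟩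
  simp only [Real.norm_eq_abs] at hmain
  have hWt : |u₁ t - u₂ t| = W * Real.exp (16 * t) := by
    rw [hW, Real.exp_neg]; field_simp
  have hWle : W ≤ 2 * Z * (4 + 32 * Z) * D := by
    rw [hWt] at hmain
    have f1 : W * 1 ≤ W * Real.exp (16 * t) := by
      gcongr; exact Real.one_le_exp (by linarith [ht.1])
    have f2 : (4 + 32 * Z) * D * t ≤ (4 + 32 * Z) * D * Z := by gcongr; exact ht.2
    linarith
  calc |u₁ z - u₂ z| ≤ W * Real.exp (16 * z) := hd z hz hzZ
    _ ≤ (2 * Z * (4 + 32 * Z) * D) * Real.exp (16 * Z) := by gcongr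
    _ = _ := by ring

/-! ### Comparison with the barrier and with `e^{-z}` -/

/-- `e^{-z}` lies below the barrier with a quantitative margin, so that small perturbations of it do
so on compact intervals. -/
lemma exp_neg_add_le_barrier {z : ℝ} (hz : 0 ≤ z) :
    Real.exp (-z) + 1 / 2 / (1 + z) ^ 2 ≤ barrier z := by
  -- the maximum of `(1 + z)² e^{-z}` is `4 / e`, attained at `z = 1`
  have h1 : ((1 + z) / 2) ^ 2 ≤ Real.exp (z - 1) := by
    have h := Real.add_one_le_exp ((z - 1) / 2)
    have h2 : Real.exp (z - 1) = Real.exp ((z - 1) / 2) ^ 2 := by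
      rw [sq, ← Real.exp_add]; congr 1; ring
    rw [h2]
    gcongr
    linarith
  have h3 : (1 + z) ^ 2 * Real.exp (-z) ≤ 3 / 2 := by
    have h4 : Real.exp (z - 1) * Real.exp (-z) * Real.exp 1 = 1 := by
      rw [← Real.exp_add, ← Real.exp_add, Real.exp_eq_one_iff]; ring
    have h5 := Real.exp_one_gt_d9
    have h6 : (1 + z) ^ 2 * Real.exp (-z) ≤ 4 * (Real.exp (z - 1) * Real.exp (-z)) := by
      have := mul_le_mul_of_nonneg_right h1 (Real.exp_pos (-z)).le
      linarith
    have h7 : 0 < Real.exp (z - 1) * Real.exp (-z) := by positivity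
    nlinarith
  rw [barrier, abs_of_nonneg hz, ← sub_nonneg]
  have h8 : 2 / (1 + z) ^ 2 - (Real.exp (-z) + 1 / 2 / (1 + z) ^ 2) =
      (3 / 2 - (1 + z) ^ 2 * Real.exp (-z)) / (1 + z) ^ 2 := by
    field_simp; ring
  rw [h8]
  exact div_nonneg (by linarith) (by positivity)

lemma exp_neg_le_barrier {z : ℝ} (hz : 0 ≤ z) : Real.exp (-z) ≤ barrier z := by
  have : 0 ≤ 1 / 2 / (1 + z) ^ 2 := by positivity
  linarith [exp_neg_add_le_barrier hz]

/-- At `θ = 1/2`, `δ = 0` the profile is exactly `e^{-z}`. -/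
lemma isClippedSolution_exp : IsClippedSolution (1 / 2) 0 fun z => Real.exp (-z) where
  zero := by simp
  hasDerivAt z hz := by
    have h := (hasDerivAt_neg z).exp
    refine h.congr_deriv ?_
    have hz2 : (0:ℝ) ≤ 1 / 2 * z := by linarith
    simp only [clippedRHS]
    have hsq : Real.exp (-(1 / 2 * z)) ^ 2 = Real.exp (-z) := by
      rw [sq, ← Real.exp_add]; congr 1; ring
    rw [clip_of_mem (z := 1 / 2 * z) (Real.exp_pos _).le (exp_neg_le_barrier hz2), hsq]
    ring

namespace IsClippedSolution

variable {θ δ : ℝ} {u : ℝ → ℝ}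

/-- Below zero the clipped equation reads `u' ≤ 0`. The comparison function is increasing and
negative, which makes the comparison strict. -/
lemma neg_of_neg (h : IsClippedSolution θ δ u) {a z : ℝ} (ha : 0 ≤ a) (hua : u a < 0)
    (haz : a ≤ z) : u z < 0 := by
  have hB : ∀ x, HasDerivAt (fun x => u a * Real.exp (a - x)) (-(u a * Real.exp (a - x))) x := by
    intro x
    refine ((((hasDerivAt_id x).const_sub a).exp).const_mul (u a)).congr_deriv ?_
    simp only [id]; ring
  have := image_le_of_deriv_right_lt_deriv_boundary (a := a) (b := z)
    (h.continuousOn.mono fun x hx => ha.trans hx.1)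
    (fun x hx => (h.hasDerivAt x (ha.trans hx.1)).hasDerivWithinAt)
    (by simp) hB (fun x _ hx => ?_) ⟨haz, le_rfl⟩
  · exact this.trans_lt (mul_neg_of_neg_of_pos hua (Real.exp_pos _))
  · have hneg : u a * Real.exp (a - x) < 0 := mul_neg_of_neg_of_pos hua (Real.exp_pos _)
    rw [clippedRHS, clip_of_nonpos (by rw [hx]; exact hneg.le)]
    have := sq_nonneg (clip (θ * x) (u (θ * x)))
    simp only [ne_eq, OfNat.ofNat_ne_zero, not_false_eq_true, zero_pow, mul_zero]
    linarith

/-- On `[40, ∞)` the barrier `m` satisfies `m(θ z)² < -m'(z)`, so a solution can cross it only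
upwards. -/
lemma barrier_le_of_barrier_le (h : IsClippedSolution θ δ u) (hθ : 2 / 5 ≤ θ) (hδ : 0 ≤ δ)
    {a z : ℝ} (ha : 40 ≤ a) (hua : barrier a ≤ u a) (haz : a ≤ z) : barrier z ≤ u z := by
  have hpos : ∀ x ∈ Set.Icc a z, 40 ≤ x := fun x hx => ha.trans hx.1
  have hd : ∀ x, 40 ≤ x → HasDerivAt barrier (-(4 / (1 + x) ^ 3)) x := by
    intro x hx
    have h1 : HasDerivAt (fun x : ℝ => 2 / (1 + x) ^ 2) (-(4 / (1 + x) ^ 3)) x := by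
      have h2 := (((hasDerivAt_id x).const_add 1).pow 2)
      have h3 := (hasDerivAt_const x (2:ℝ)).div h2 (by simp only [id, Pi.pow_apply]; positivity)
      refine h3.congr_deriv ?_
      simp only [id, Pi.pow_apply]
      field_simp
      ring
    refine h1.congr_of_eventuallyEq ?_
    filter_upwards [lt_mem_nhds (show (0:ℝ) < x by linarith)] with y hy
    rw [barrier, abs_of_pos hy]
  refine image_le_of_deriv_right_lt_deriv_boundary' (a := a) (b := z) (f := barrier) (B := u)
    (f' := fun x => -(4 / (1 + x) ^ 3)) (B' := clippedRHS θ δ u)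
    continuous_barrier.continuousOn
    (fun x hx => (hd x (hpos x ⟨hx.1, hx.2.le⟩)).hasDerivWithinAt) hua
    (h.continuousOn.mono fun x hx => (by norm_num : (0:ℝ) ≤ 40).trans (hpos x hx))
    (fun x hx => (h.hasDerivAt x (by linarith [hx.1])).hasDerivWithinAt)
    (fun x hx _ => ?_) ⟨haz, le_rfl⟩
  have hx0 : 40 ≤ x := ha.trans hx.1
  have h1 : clip (θ * x) (u (θ * x)) ^ 2 ≤ barrier (θ * x) ^ 2 := by
    gcongr
    · exact clip_nonneg _ _
    · exact clip_le_barrier _ _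
  have h2 : barrier (θ * x) ^ 2 < 4 / (1 + x) ^ 3 := by
    rw [barrier, abs_of_nonneg (by positivity), div_pow, ← pow_mul]
    have h3 : (2 / 5 * (1 + x)) ^ 4 ≤ (1 + θ * x) ^ 4 := by
      gcongr
      nlinarith
    have h4 : (1 + x) ^ 3 < (2 / 5 * (1 + x)) ^ 4 := by
      have : 0 < (1 + x) ^ 3 := by positivity
      nlinarith
    rw [div_lt_div_iff₀ (by positivity) (by positivity)]
    norm_num
    linarith
  have h5 : 0 ≤ δ * clip x (u x) ^ 2 := by positivity
  simp only [clippedRHS]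
  linarith

/-- The clipping is inactive where the solution lies between zero and the barrier. -/
lemma hasDerivAt_of_mem (h : IsClippedSolution θ δ u) {z : ℝ} (hz : 0 ≤ z)
    (h₁ : 0 ≤ u z ∧ u z ≤ barrier z) (h₂ : 0 ≤ u (θ * z) ∧ u (θ * z) ≤ barrier (θ * z)) :
    HasDerivAt u (δ * u z ^ 2 - u (θ * z) ^ 2) z := by
  have := h.hasDerivAt z hz
  rwa [clippedRHS, clip_of_mem h₁.1 h₁.2, clip_of_mem h₂.1 h₂.2] at this

end IsClippedSolution

/-- If `θ` is near `1/2` and `δ` near `0`, the solution is below the barrier on `[0, 40]`. -/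
lemma exists_le_barrier_of_near :
    ∃ η : ℝ, 0 < η ∧ η ≤ 1 / 10 ∧ ∀ θ δ u, |θ - 1 / 2| ≤ η → 0 ≤ δ → δ ≤ η →
      IsClippedSolution θ δ u → ∀ z, 0 ≤ z → z ≤ 40 → u z ≤ barrier z := by
  set K : ℝ := Real.exp (16 * 40) * (2 * 40 * (4 + 32 * 40)) with hK
  have hK0 : 0 < K := by positivity
  refine ⟨min (1 / 10) (1 / 2 / 41 ^ 2 / (2 * K)), lt_min (by norm_num) (by positivity),
    min_le_left _ _, fun θ δ u hθ hδ₀ hδ hu z hz hz40 => ?_⟩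
  obtain ⟨hθa, hθb⟩ := abs_le.1 (hθ.trans (min_le_left _ _))
  have h1 := hu.abs_sub_le_of_parameters isClippedSolution_exp ⟨by linarith, by linarith⟩
    (by norm_num) ⟨hδ₀, by linarith [hδ.trans (min_le_left _ _)]⟩ ⟨le_rfl, by norm_num⟩ hz hz40
  rw [← hK, sub_zero, abs_of_nonneg hδ₀] at h1
  have h2 : K * (|θ - 1 / 2| + δ) ≤ 1 / 2 / 41 ^ 2 := by
    have h3 := hθ.trans (min_le_right _ _)
    have h4 := hδ.trans (min_le_right _ _)
    calc K * (|θ - 1 / 2| + δ) ≤ K * (1 / 2 / 41 ^ 2 / (2 * K) + 1 / 2 / 41 ^ 2 / (2 * K)) := by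
          gcongr
      _ = _ := by field_simp; norm_num
  have h5 : (1:ℝ) / 2 / 41 ^ 2 ≤ 1 / 2 / (1 + z) ^ 2 := by
    gcongr
    linarith
  linarith [exp_neg_add_le_barrier hz, le_abs_self (u z - Real.exp (-z))]

/-! ### The hazard rate for `δ = 0` -/

/-- A self-propagating sign: if `g' T < 0` whenever `g T` is the minimum of `g` over `[0, T]`, then
`g' < 0` throughout. The least point where `g' ≥ 0` would contradict the hypothesis. -/
lemma deriv_neg_of_delay {g g' : ℝ → ℝ} {Y : ℝ}
    (hg : ∀ z ∈ Set.Icc 0 Y, HasDerivAt g (g' z) z) (hc : ContinuousOn g' (Set.Icc 0 Y))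
    (h : ∀ T ∈ Set.Icc 0 Y, (∀ z ∈ Set.Icc 0 T, g T ≤ g z) → g' T < 0) :
    ∀ z ∈ Set.Icc 0 Y, g' z < 0 := by
  by_contra! hbad
  obtain ⟨z, hz, hgz⟩ := hbad
  have hcl : IsCompact (Set.Icc 0 Y ∩ g' ⁻¹' Set.Ici 0) :=
    isCompact_Icc.of_isClosed_subset (hc.preimage_isClosed_of_isClosed isClosed_Icc isClosed_Ici)
      Set.inter_subset_left
  obtain ⟨T, ⟨hT, hgT⟩, hmin⟩ := hcl.exists_isLeast ⟨z, hz, hgz⟩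
  refine absurd (h T hT fun s hs => ?_) (not_lt.2 hgT)
  have hsub : ∀ x ∈ Set.Icc 0 T, x ∈ Set.Icc 0 Y := fun x hx => ⟨hx.1, hx.2.trans hT.2⟩
  refine antitoneOn_of_hasDerivWithinAt_nonpos (f' := g') (convex_Icc 0 T)
    (fun x hx => (hg x (hsub x hx)).continuousAt.continuousWithinAt)
    (fun x hx => (hg x (hsub x (interior_subset hx))).hasDerivWithinAt) (fun x hx => ?_) hs
    ⟨hT.1, le_rfl⟩ hs.2
  rw [interior_Icc] at hx
  by_contra! hx0
  exact absurd (hmin ⟨hsub x ⟨hx.1.le, hx.2.le⟩, hx0.le⟩) (not_le.2 hx.2)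

section Hazard

variable {θ Y : ℝ} {u : ℝ → ℝ}

/-- The reciprocal hazard rate `κ(z) = u(z) / u(θ z)²` satisfies `κ' = -1 + 2 θ κ(z) / κ(θ z)`; the
quotient `κ(z) / κ(θ z)` is written out in terms of `u`. -/
lemma hasDerivAt_hazard (hθ₀ : 0 < θ) (hθ₁ : θ < 1)
    (hu : ∀ z ∈ Set.Icc 0 Y, HasDerivAt u (-u (θ * z) ^ 2) z) (hpos : ∀ z ∈ Set.Icc 0 Y, 0 < u z)
    {z : ℝ} (hz : z ∈ Set.Icc 0 Y) :
    HasDerivAt (fun z => u z / u (θ * z) ^ 2)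
      (-1 + 2 * θ * (u z * u (θ * (θ * z)) ^ 2 / u (θ * z) ^ 3)) z := by
  have hz1 : θ * z ∈ Set.Icc 0 Y :=
    ⟨mul_nonneg hθ₀.le hz.1, by nlinarith [hz.1, hz.2]⟩
  have h1 := hpos _ hz1
  have h2 : HasDerivAt (fun z => u (θ * z)) (-u (θ * (θ * z)) ^ 2 * θ) z := by
    exact ((hu _ hz1).comp z ((hasDerivAt_id z).const_mul θ)).congr_deriv (by simp)
  refine ((hu z hz).div (h2.pow 2) (by simp only [Pi.pow_apply]; positivity)).congr_deriv ?_
  simp only [Pi.pow_apply]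
  field_simp
  ring

lemma continuousOn_hazard_deriv (hθ₀ : 0 < θ) (hθ₁ : θ < 1)
    (hu : ∀ z ∈ Set.Icc 0 Y, HasDerivAt u (-u (θ * z) ^ 2) z)
    (hpos : ∀ z ∈ Set.Icc 0 Y, 0 < u z) :
    ContinuousOn (fun z => -1 + 2 * θ * (u z * u (θ * (θ * z)) ^ 2 / u (θ * z) ^ 3))
      (Set.Icc 0 Y) := by
  have hm : ∀ z ∈ Set.Icc 0 Y, θ * z ∈ Set.Icc 0 Y := fun z hz =>
    ⟨mul_nonneg hθ₀.le hz.1, by nlinarith [hz.1, hz.2]⟩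
  have c0 : ContinuousOn u (Set.Icc 0 Y) := fun z hz => (hu z hz).continuousAt.continuousWithinAt
  have cm : ContinuousOn (fun z => θ * z) (Set.Icc 0 Y) := by fun_prop
  have c1 : ContinuousOn (fun z => u (θ * z)) (Set.Icc 0 Y) := c0.comp cm hm
  have c2 : ContinuousOn (fun z => u (θ * (θ * z))) (Set.Icc 0 Y) := c1.comp cm hm
  refine continuousOn_const.add (continuousOn_const.mul ((c0.mul (c2.pow 2)).div (c1.pow 3) ?_))
  intro z hz
  have := hpos _ (hm z hz)
  positivity

/-- For `θ < 1/2` the reciprocal hazard rate decreases at least at rate `1 - 2 θ`; in particular `u`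
cannot stay positive up to `z = 1 / (1 - 2 θ)`. -/
lemma hazard_le_of_lt_half (hθ₀ : 0 < θ) (hθ₁ : θ < 1 / 2) (hu0 : u 0 = 1)
    (hu : ∀ z ∈ Set.Icc 0 Y, HasDerivAt u (-u (θ * z) ^ 2) z) (hpos : ∀ z ∈ Set.Icc 0 Y, 0 < u z)
    {z : ℝ} (hz : z ∈ Set.Icc 0 Y) :
    u z / u (θ * z) ^ 2 ≤ 1 - (1 - 2 * θ) * z := by
  set κ : ℝ → ℝ := fun z => u z / u (θ * z) ^ 2 with hκ
  set κ' : ℝ → ℝ := fun z => -1 + 2 * θ * (u z * u (θ * (θ * z)) ^ 2 / u (θ * z) ^ 3) with hκ'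
  have hd : ∀ z ∈ Set.Icc 0 Y, HasDerivAt κ (κ' z) z := fun z hz =>
    hasDerivAt_hazard hθ₀ (by linarith) hu hpos hz
  have hm : ∀ z ∈ Set.Icc 0 Y, θ * z ∈ Set.Icc 0 z := fun z hz =>
    ⟨mul_nonneg hθ₀.le hz.1, by nlinarith [hz.1, hz.2]⟩
  have hm2 : ∀ z ∈ Set.Icc 0 Y, θ * z ∈ Set.Icc 0 Y := fun z hz =>
    ⟨(hm z hz).1, (hm z hz).2.trans hz.2⟩
  have step : ∀ T ∈ Set.Icc 0 Y, (∀ z ∈ Set.Icc 0 T, κ T ≤ κ z) → κ' T ≤ -(1 - 2 * θ) := by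
    intro T hT hle
    have h1 := hpos _ (hm2 T hT)
    have h2 := hpos _ (hm2 _ (hm2 T hT))
    have h3 : κ T ≤ κ (θ * T) := hle _ (hm T hT)
    have h4 : u T * u (θ * (θ * T)) ^ 2 / u (θ * T) ^ 3 ≤ 1 := by
      simp only [hκ] at h3
      rw [div_le_div_iff₀ (by positivity) (by positivity)] at h3
      rw [div_le_one (by positivity)]
      linarith
    simp only [hκ']
    nlinarith
  have hneg := deriv_neg_of_delay hd (continuousOn_hazard_deriv hθ₀ (by linarith) hu hpos)
    fun T hT hle => (step T hT hle).trans_lt (by linarith)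
  have hanti : AntitoneOn κ (Set.Icc 0 Y) :=
    antitoneOn_of_hasDerivWithinAt_nonpos (convex_Icc 0 Y)
      (fun x hx => (hd x hx).continuousAt.continuousWithinAt)
      (fun x hx => (hd x (interior_subset hx)).hasDerivWithinAt)
      fun x hx => (hneg x (interior_subset hx)).le
  have hle : ∀ x ∈ Set.Icc 0 Y, κ' x ≤ -(1 - 2 * θ) := fun x hx => step x hx fun s hs =>
    hanti ⟨hs.1, hs.2.trans hx.2⟩ hx hs.2
  have hfin := antitoneOn_of_hasDerivWithinAt_nonpos (f := fun x => κ x + (1 - 2 * θ) * x)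
      (f' := fun x => κ' x + (1 - 2 * θ) * 1) (convex_Icc 0 Y)
      (fun x hx => ((hd x hx).continuousAt.add (by fun_prop)).continuousWithinAt)
      (fun x hx => ((hd x (interior_subset hx)).add
        ((hasDerivAt_id x).const_mul _)).hasDerivWithinAt)
      (fun x hx => by linarith [hle x (interior_subset hx)])
      ⟨le_rfl, hz.1.trans hz.2⟩ hz hz.1
  simp [hκ, hu0] at hfin
  linarith

/-- For `θ > 1/2` the reciprocal hazard rate grows at least at rate `2 θ - 1`. -/
lemma le_hazard_of_half_lt (hθ₀ : 1 / 2 < θ) (hθ₁ : θ < 1) (hu0 : u 0 = 1)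
    (hu : ∀ z ∈ Set.Icc 0 Y, HasDerivAt u (-u (θ * z) ^ 2) z) (hpos : ∀ z ∈ Set.Icc 0 Y, 0 < u z)
    {z : ℝ} (hz : z ∈ Set.Icc 0 Y) :
    1 + (2 * θ - 1) * z ≤ u z / u (θ * z) ^ 2 := by
  have hθ : 0 < θ := by linarith
  set κ : ℝ → ℝ := fun z => u z / u (θ * z) ^ 2 with hκ
  set κ' : ℝ → ℝ := fun z => -1 + 2 * θ * (u z * u (θ * (θ * z)) ^ 2 / u (θ * z) ^ 3) with hκ'
  have hd : ∀ z ∈ Set.Icc 0 Y, HasDerivAt κ (κ' z) z := fun z hz =>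
    hasDerivAt_hazard hθ (by linarith) hu hpos hz
  have hm : ∀ z ∈ Set.Icc 0 Y, θ * z ∈ Set.Icc 0 z := fun z hz =>
    ⟨mul_nonneg hθ.le hz.1, by nlinarith [hz.1, hz.2]⟩
  have hm2 : ∀ z ∈ Set.Icc 0 Y, θ * z ∈ Set.Icc 0 Y := fun z hz =>
    ⟨(hm z hz).1, (hm z hz).2.trans hz.2⟩
  have step : ∀ T ∈ Set.Icc 0 Y, (∀ z ∈ Set.Icc 0 T, κ z ≤ κ T) → 2 * θ - 1 ≤ κ' T := by
    intro T hT hle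
    have h1 := hpos _ (hm2 T hT)
    have h2 := hpos _ (hm2 _ (hm2 T hT))
    have h3 : κ (θ * T) ≤ κ T := hle _ (hm T hT)
    have h4 : 1 ≤ u T * u (θ * (θ * T)) ^ 2 / u (θ * T) ^ 3 := by
      simp only [hκ] at h3
      rw [div_le_div_iff₀ (by positivity) (by positivity)] at h3
      rw [one_le_div (by positivity)]
      linarith
    simp only [hκ']
    nlinarith
  have hneg := deriv_neg_of_delay (g := fun z => -κ z) (g' := fun z => -κ' z)
    (fun z hz => (hd z hz).neg) (continuousOn_hazard_deriv hθ (by linarith) hu hpos).neg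
    fun T hT hle => by linarith [step T hT fun z hz => neg_le_neg_iff.1 (hle z hz)]
  have hmono : MonotoneOn κ (Set.Icc 0 Y) :=
    monotoneOn_of_hasDerivWithinAt_nonneg (convex_Icc 0 Y)
      (fun x hx => (hd x hx).continuousAt.continuousWithinAt)
      (fun x hx => (hd x (interior_subset hx)).hasDerivWithinAt)
      fun x hx => by linarith [hneg x (interior_subset hx)]
  have hle : ∀ x ∈ Set.Icc 0 Y, 2 * θ - 1 ≤ κ' x := fun x hx => step x hx fun s hs =>
    hmono ⟨hs.1, hs.2.trans hx.2⟩ hx hs.2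
  have hfin := monotoneOn_of_hasDerivWithinAt_nonneg (f := fun x => κ x - (2 * θ - 1) * x)
      (f' := fun x => κ' x - (2 * θ - 1) * 1) (convex_Icc 0 Y)
      (fun x hx => ((hd x hx).continuousAt.sub (by fun_prop)).continuousWithinAt)
      (fun x hx => ((hd x (interior_subset hx)).sub
        ((hasDerivAt_id x).const_mul _)).hasDerivWithinAt)
      (fun x hx => by linarith [hle x (interior_subset hx)])
      ⟨le_rfl, hz.1.trans hz.2⟩ hz hz.1
  simp [hκ, hu0] at hfin
  linarith

lemma le_exp_neg_of_lt_half (hθ₀ : 0 < θ) (hθ₁ : θ < 1 / 2) (hu0 : u 0 = 1)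
    (hu : ∀ z ∈ Set.Icc 0 Y, HasDerivAt u (-u (θ * z) ^ 2) z) (hpos : ∀ z ∈ Set.Icc 0 Y, 0 < u z)
    {z : ℝ} (hz : z ∈ Set.Icc 0 Y) : u z ≤ Real.exp (-z) := by
  have hd : ∀ x ∈ Set.Icc 0 Y, HasDerivAt (fun x => u x * Real.exp x)
      (-u (θ * x) ^ 2 * Real.exp x + u x * Real.exp x) x := fun x hx =>
    (hu x hx).mul (Real.hasDerivAt_exp x)
  have := antitoneOn_of_hasDerivWithinAt_nonpos (convex_Icc 0 Y)
    (fun x hx => (hd x hx).continuousAt.continuousWithinAt)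
    (fun x hx => (hd x (interior_subset hx)).hasDerivWithinAt)
    (fun x hx => by
      have hx := interior_subset hx
      have h1 := hazard_le_of_lt_half hθ₀ hθ₁ hu0 hu hpos hx
      have h2 := hpos (θ * x) ⟨mul_nonneg hθ₀.le hx.1, by nlinarith [hx.1, hx.2]⟩
      have h3 : 0 ≤ (1 - 2 * θ) * x := mul_nonneg (by linarith) hx.1
      have h4 : u x ≤ u (θ * x) ^ 2 := (div_le_one (by positivity)).1 (h1.trans (by linarith))
      have h5 := Real.exp_pos x
      nlinarith)
    ⟨le_rfl, hz.1.trans hz.2⟩ hz hz.1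
  simp only [hu0, Real.exp_zero, mul_one] at this
  rw [Real.exp_neg, ← one_div, le_div_iff₀ (Real.exp_pos z)]
  exact this

/-- For `θ > 1/2` the bound on the hazard rate integrates to an algebraic lower bound for `u`. The
exponent `1 / (2 θ - 1)` is rounded up to a natural number. -/
lemma one_le_mul_pow_of_half_lt (hθ₀ : 1 / 2 < θ) (hθ₁ : θ < 1) (hu0 : u 0 = 1)
    (hu : ∀ z ∈ Set.Icc 0 Y, HasDerivAt u (-u (θ * z) ^ 2) z) (hpos : ∀ z ∈ Set.Icc 0 Y, 0 < u z)
    {N : ℕ} (hN : 1 ≤ (N + 1) * (2 * θ - 1))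
    {z : ℝ} (hz : z ∈ Set.Icc 0 Y) : 1 ≤ u z * (1 + (2 * θ - 1) * z) ^ (N + 1) := by
  have hθ : 0 < θ := by linarith
  have hl : ∀ x, HasDerivAt (fun x => (1 + (2 * θ - 1) * x) ^ (N + 1))
      ((N + 1) * (1 + (2 * θ - 1) * x) ^ N * (2 * θ - 1)) x := by
    intro x
    have := (((hasDerivAt_id x).const_mul (2 * θ - 1)).const_add 1).pow (N + 1)
    refine this.congr_deriv ?_
    simp
  have hd := fun x (hx : x ∈ Set.Icc 0 Y) => (hu x hx).mul (hl x)
  have := monotoneOn_of_hasDerivWithinAt_nonneg (convex_Icc 0 Y)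
    (fun x hx => (hd x hx).continuousAt.continuousWithinAt)
    (fun x hx => (hd x (interior_subset hx)).hasDerivWithinAt)
    (fun x hx => by
      have hx := interior_subset hx
      have h1 := le_hazard_of_half_lt hθ₀ hθ₁ hu0 hu hpos hx
      have h2 := hpos (θ * x) ⟨mul_nonneg hθ.le hx.1, by nlinarith [hx.1, hx.2]⟩
      have h3 : 0 ≤ (2 * θ - 1) * x := mul_nonneg (by linarith) hx.1
      have h4 := hpos x hx
      rw [le_div_iff₀ (by positivity)] at h1
      have h5 : 0 ≤ (1 + (2 * θ - 1) * x) ^ N := by positivity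
      have h6 : u x * 1 ≤ u x * ((N + 1) * (2 * θ - 1)) := by gcongr
      have h7 : 0 ≤ (u x * ((N + 1) * (2 * θ - 1)) - (1 + (2 * θ - 1) * x) * u (θ * x) ^ 2) *
        (1 + (2 * θ - 1) * x) ^ N := mul_nonneg (by linarith) h5
      rw [pow_succ (1 + (2 * θ - 1) * x) N]
      linarith)
    ⟨le_rfl, hz.1.trans hz.2⟩ hz hz.1
  simpa [hu0] using this

end Hazard

/-! ### Decay, and the two sides of `θ = 1/2` -/

/-- `u` is a positive solution of the (unclipped) delay equation `u'(z) = δ u(z)² - u(θ z)²`,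
`u 0 = 1`, on `[0, ∞)` that stays below the barrier. -/
structure IsDecayingProfile (θ δ : ℝ) (u : ℝ → ℝ) : Prop where
  zero : u 0 = 1
  hasDerivAt : ∀ z : ℝ, 0 ≤ z → HasDerivAt u (δ * u z ^ 2 - u (θ * z) ^ 2) z
  pos : ∀ z : ℝ, 0 ≤ z → 0 < u z
  le_barrier : ∀ z : ℝ, 0 ≤ z → u z ≤ barrier z

namespace IsClippedSolution

variable {θ δ : ℝ} {u : ℝ → ℝ}

/-- A nonnegative solution has no zero: a zero `z` is a minimum, so `u'(z) = 0` forces `u(θ z) = 0`,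
and the zeros `θ ^ n * z` would accumulate at `0`, where `u = 1`. -/
lemma pos_of_nonneg (h : IsClippedSolution θ δ u) (hθ₀ : 0 < θ) (hθ₁ : θ < 1)
    (hnn : ∀ z, 0 ≤ z → 0 ≤ u z) {z : ℝ} (hz : 0 ≤ z) : 0 < u z := by
  refine lt_of_le_of_ne (hnn z hz) fun h0 => ?_
  have step : ∀ x, 0 ≤ x → u x = 0 → u (θ * x) = 0 := by
    intro x hx hux
    have hx0 : 0 < x := by
      refine lt_of_le_of_ne hx fun h0 => ?_
      rw [← h0, h.zero] at hux
      norm_num at hux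
    have hmin : IsLocalMin u x := by
      filter_upwards [lt_mem_nhds hx0] with y hy
      rw [hux]
      exact hnn y hy.le
    have h1 := hmin.hasDerivAt_eq_zero (h.hasDerivAt x hx)
    have hx1 := hnn (θ * x) (by positivity)
    rw [clippedRHS, hux, clip_of_nonpos le_rfl] at h1
    have h2 : clip (θ * x) (u (θ * x)) = 0 := by
      have : clip (θ * x) (u (θ * x)) ^ 2 = 0 := by linarith
      exact pow_eq_zero_iff (two_ne_zero) |>.1 this
    rw [clip] at h2
    have h3 : min (u (θ * x)) (barrier (θ * x)) ≤ 0 := h2 ▸ le_max_right _ _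
    rcases min_le_iff.1 h3 with h4 | h4
    · exact le_antisymm h4 hx1
    · exact absurd h4 (not_le.2 (barrier_pos _))
  have hall : ∀ n : ℕ, u (θ ^ n * z) = 0 := by
    intro n
    induction n with
    | zero => simpa using h0.symm
    | succ n ih => rw [pow_succ', mul_assoc]; exact step _ (by positivity) ih
  have hlim : Tendsto (fun n : ℕ => θ ^ n * z) atTop (𝓝 0) := by
    simpa using (tendsto_pow_atTop_nhds_zero_of_lt_one hθ₀.le hθ₁).mul_const z
  have h5 := (h.hasDerivAt 0 le_rfl).continuousAt.tendsto.comp hlim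
  rw [h.zero] at h5
  have h6 : Tendsto (fun _ : ℕ => (0:ℝ)) atTop (𝓝 1) := h5.congr hall
  exact zero_ne_one (tendsto_nhds_unique tendsto_const_nhds h6)

lemma isDecayingProfile (h : IsClippedSolution θ δ u) (hθ₀ : 0 < θ) (hθ₁ : θ < 1)
    (hnn : ∀ z, 0 ≤ z → 0 ≤ u z) (hle : ∀ z, 0 ≤ z → u z ≤ barrier z) :
    IsDecayingProfile θ δ u where
  zero := h.zero
  hasDerivAt z hz := h.hasDerivAt_of_mem hz ⟨hnn z hz, hle z hz⟩
    ⟨hnn _ (by positivity), hle _ (by positivity)⟩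
  pos _ hz := h.pos_of_nonneg hθ₀ hθ₁ hnn hz
  le_barrier := hle

end IsClippedSolution

/-- Decay by iteration: since `u → 0` and `u' ≥ -u(θ ·)²`, a bound `u ≤ a / s` on `[Z, ∞)` implies
`u ≤ (a / θ)² / s` on `[Z / θ, ∞)`, and `a / θ²` is squared in each step. -/
lemma IsDecayingProfile.mul_le {θ δ : ℝ} {u : ℝ → ℝ} (h : IsDecayingProfile θ δ u)
    (hθ₀ : 2 / 5 ≤ θ) (hδ : 0 ≤ δ) (n : ℕ) {z : ℝ} (hz : 40 / θ ^ n ≤ z) :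
    z * u z ≤ θ ^ 2 * (1 / 2) ^ 2 ^ n := by
  have hθ : 0 < θ := by linarith
  induction n generalizing z with
  | zero =>
    have hz40 : 40 ≤ z := by simpa using hz
    have h1 := h.le_barrier z (by linarith)
    rw [barrier, abs_of_nonneg (by linarith)] at h1
    have h2 : z * u z ≤ z * (2 / (1 + z) ^ 2) := by gcongr
    have h3 : z * (2 / (1 + z) ^ 2) ≤ 2 / 41 := by
      rw [← mul_div_assoc, div_le_div_iff₀ (by positivity) (by norm_num)]
      nlinarith
    have h4 : (2 / 5) ^ 2 ≤ θ ^ 2 := by gcongr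
    norm_num at h4 ⊢
    linarith
  | succ n ih =>
    set a := θ ^ 2 * (1 / 2 : ℝ) ^ 2 ^ n with ha
    have hz0 : 0 < z := lt_of_lt_of_le (by positivity) hz
    have hs : ∀ s, z ≤ s → 40 / θ ^ n ≤ θ * s := by
      intro s hs
      calc 40 / θ ^ n = θ * (40 / θ ^ (n + 1)) := by rw [pow_succ]; field_simp
        _ ≤ θ * s := by gcongr; exact hz.trans hs
    have hd : ∀ s ∈ Set.Ici z, HasDerivAt (fun s => u s - (a / θ) ^ 2 * s⁻¹)
        (δ * u s ^ 2 - u (θ * s) ^ 2 - (a / θ) ^ 2 * -(s ^ 2)⁻¹) s := fun s hs =>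
      (h.hasDerivAt s (hz0.le.trans hs)).sub
        ((hasDerivAt_inv (hz0.trans_le hs).ne').const_mul _)
    -- the difference increases to its limit `0` at infinity, so it is nonpositive
    have hmono := monotoneOn_of_hasDerivWithinAt_nonneg (convex_Ici z)
      (fun s hs => (hd s hs).continuousAt.continuousWithinAt)
      (fun s hs => (hd s (interior_subset hs)).hasDerivWithinAt)
      (fun s hs' => by
        have hs' := interior_subset hs'
        have hs0 : 0 < s := hz0.trans_le hs'
        have h1 := ih (hs s hs')
        have h2 := h.pos (θ * s) (by positivity)
        have h3 : u (θ * s) ≤ a / θ * s⁻¹ := by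
          rw [← div_eq_mul_inv, div_div, le_div_iff₀ (by positivity)]
          linarith
        have h4 : u (θ * s) ^ 2 ≤ (a / θ * s⁻¹) ^ 2 := by gcongr
        rw [mul_pow, inv_pow] at h4
        have h5 : 0 ≤ δ * u s ^ 2 := by positivity
        linarith)
    have hlim : Tendsto (fun s => u s - (a / θ) ^ 2 * s⁻¹) atTop (𝓝 0) := by
      have h1 : Tendsto u atTop (𝓝 0) := by
        refine tendsto_of_tendsto_of_tendsto_of_le_of_le' tendsto_const_nhds
          ((tendsto_inv_atTop_zero (𝕜 := ℝ)).const_mul 2 |>.trans (by simp)) ?_ ?_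
        · filter_upwards [eventually_ge_atTop 0] with s hs using (h.pos s hs).le
        · filter_upwards [eventually_gt_atTop 0] with s hs
          refine (h.le_barrier s hs.le).trans ?_
          rw [barrier, abs_of_pos hs, ← div_eq_mul_inv]
          gcongr
          nlinarith
      simpa using h1.sub ((tendsto_inv_atTop_zero (𝕜 := ℝ)).const_mul ((a / θ) ^ 2))
    have hfin : u z - (a / θ) ^ 2 * z⁻¹ ≤ 0 := by
      refine ge_of_tendsto hlim ?_
      filter_upwards [eventually_ge_atTop z] with s hs
      exact hmono (Set.self_mem_Ici) hs hs
    have h6 : (a / θ) ^ 2 = θ ^ 2 * (1 / 2) ^ 2 ^ (n + 1) := by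
      rw [ha, pow_succ 2 n, pow_mul (1 / 2 : ℝ)]
      field_simp
    rw [← h6]
    have h7 : z * u z ≤ z * ((a / θ) ^ 2 * z⁻¹) := by gcongr; linarith
    refine h7.trans (le_of_eq ?_)
    field_simp

/-- For `δ = 0` and `θ < 1/2` the solution becomes negative. As long as it is positive it stays below
`e^{-z}`, hence below the barrier, so the hazard-rate bound applies. -/
lemma IsClippedSolution.exists_neg_of_lt_half {θ : ℝ} {u : ℝ → ℝ} (h : IsClippedSolution θ 0 u)
    (hθ₀ : 0 < θ) (hθ₁ : θ < 1 / 2) (h40 : ∀ z, 0 ≤ z → z ≤ 40 → u z ≤ barrier z) :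
    ∃ z, 0 ≤ z ∧ u z < 0 := by
  by_contra! hnn
  have hpos : ∀ z, 0 ≤ z → 0 < u z := fun z hz => h.pos_of_nonneg hθ₀ (by linarith) hnn hz
  have hd : ∀ Y, (∀ z, 0 ≤ z → z ≤ Y → u z ≤ barrier z) →
      ∀ z ∈ Set.Icc 0 (Y / θ), HasDerivAt u (-u (θ * z) ^ 2) z := by
    intro Y hY z hz
    have hθz : 0 ≤ θ * z := mul_nonneg hθ₀.le hz.1
    have h1 := h.hasDerivAt z hz.1
    rw [clippedRHS, clip_of_mem (hnn _ hθz) (hY _ hθz (by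
      rw [mul_comm]; exact (le_div_iff₀ hθ₀).1 hz.2))] at h1
    simpa using h1
  -- on `[0, Y / θ]` the delay term only sees `[0, Y]`, so the bound propagates by factors `1 / θ`
  have hle : ∀ n : ℕ, ∀ z, 0 ≤ z → z ≤ 40 / θ ^ n → u z ≤ barrier z := by
    intro n
    induction n with
    | zero => simpa using h40
    | succ n ih =>
      intro z hz hzn
      rw [pow_succ, ← div_div] at hzn
      exact (le_exp_neg_of_lt_half hθ₀ hθ₁ h.zero (hd _ ih) (fun z hz => hpos z hz.1)
        ⟨hz, hzn⟩).trans (exp_neg_le_barrier hz)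
  set Y := 1 / (1 - 2 * θ) with hY
  have hY0 : 0 < Y := by rw [hY]; exact div_pos one_pos (by linarith)
  have hleY : ∀ z, 0 ≤ z → z ≤ Y → u z ≤ barrier z := by
    intro z hz hzY
    obtain ⟨n, hn⟩ := exists_pow_lt_of_lt_one (show 0 < 40 / Y by positivity)
      (show θ < 1 by linarith)
    refine hle n z hz (hzY.trans ?_)
    rw [le_div_iff₀ (by positivity)]
    rw [lt_div_iff₀ hY0] at hn
    linarith
  have hYθ : Y ≤ Y / θ := by
    rw [le_div_iff₀ hθ₀]; nlinarith
  have hfin := hazard_le_of_lt_half hθ₀ hθ₁ h.zero (hd _ hleY) (fun z hz => hpos z hz.1)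
    ⟨hY0.le, hYθ⟩
  have h1 : (1 - 2 * θ) * Y = 1 := by
    rw [hY, mul_one_div, div_self (by linarith)]
  have h2 := hpos Y hY0.le
  have h3 := hpos (θ * Y) (by positivity)
  have h4 : 0 < u Y / u (θ * Y) ^ 2 := by positivity
  linarith

/-- For `δ = 0` and `θ > 1/2` the solution exceeds the barrier. Otherwise it would be a decaying
profile, whose decay contradicts the algebraic lower bound. -/
lemma IsClippedSolution.exists_barrier_lt_of_half_lt {θ : ℝ} {u : ℝ → ℝ}
    (h : IsClippedSolution θ 0 u) (hθ₀ : 1 / 2 < θ) (hθ₁ : θ < 1)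
    (h40 : ∀ z, 0 ≤ z → z ≤ 40 → u z ≤ barrier z) :
    ∃ z, 40 ≤ z ∧ barrier z < u z := by
  by_contra! h41
  have hθ : 0 < θ := by linarith
  have hle : ∀ z, 0 ≤ z → u z ≤ barrier z := fun z hz =>
    (le_total z 40).elim (h40 z hz) (h41 z)
  obtain ⟨N, hN⟩ := exists_nat_ge (1 / (2 * θ - 1))
  have hN' : 1 ≤ ((N : ℝ) + 1) * (2 * θ - 1) := by
    rw [div_le_iff₀ (by linarith)] at hN
    linarith
  -- a lower bound valid as long as `u` is positive
  have hlow : ∀ Y, 0 ≤ Y → (∀ z ∈ Set.Icc 0 Y, 0 < u z) →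
      1 ≤ u Y * (1 + (2 * θ - 1) * Y) ^ (N + 1) := by
    intro Y hY hpos
    refine one_le_mul_pow_of_half_lt hθ₀ hθ₁ h.zero (fun z hz => ?_) hpos hN' ⟨hY, le_rfl⟩
    have hθz : θ * z ∈ Set.Icc 0 Y := ⟨mul_nonneg hθ.le hz.1, by nlinarith [hz.1, hz.2]⟩
    have h1 := h.hasDerivAt z hz.1
    rw [clippedRHS, clip_of_mem (hpos _ hθz).le (hle _ hθz.1)] at h1
    simpa using h1
  have hpos : ∀ z, 0 ≤ z → 0 < u z := by
    by_contra! hbad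
    obtain ⟨z, hz, huz⟩ := hbad
    have hcl : IsCompact (Set.Icc 0 z ∩ u ⁻¹' Set.Iic 0) :=
      isCompact_Icc.of_isClosed_subset
        ((h.continuousOn.mono fun x hx => hx.1).preimage_isClosed_of_isClosed isClosed_Icc
          isClosed_Iic) Set.inter_subset_left
    obtain ⟨T, ⟨hT, huT⟩, hmin⟩ := hcl.exists_isLeast ⟨z, ⟨hz, le_rfl⟩, huz⟩
    have huT : u T ≤ 0 := huT
    have hT0 : 0 < T := by
      refine lt_of_le_of_ne hT.1 fun h0 => ?_
      rw [← h0, h.zero] at huT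
      norm_num at huT
    have hbelow : ∀ x, 0 ≤ x → x < T → 0 < u x := by
      intro x hx hxT
      by_contra! hux
      exact absurd (hmin ⟨⟨hx, hxT.le.trans hT.2⟩, hux⟩) (not_le.2 hxT)
    have hcont : ContinuousAt (fun x => u x * (1 + (2 * θ - 1) * x) ^ (N + 1)) T :=
      (h.hasDerivAt T hT.1).continuousAt.mul (by fun_prop)
    have h1 : 1 ≤ u T * (1 + (2 * θ - 1) * T) ^ (N + 1) := by
      refine ge_of_tendsto (hcont.tendsto.mono_left (nhdsWithin_le_nhds (s := Set.Iio T))) ?_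
      filter_upwards [Ioo_mem_nhdsLT hT0] with x hx
      exact hlow x hx.1.le fun y hy => hbelow y hy.1 (hy.2.trans_lt hx.2)
    have h2 : 0 ≤ (1 + (2 * θ - 1) * T) ^ (N + 1) := by
      have : 0 ≤ (2 * θ - 1) * T := mul_nonneg (by linarith) hT.1
      positivity
    linarith [mul_nonpos_of_nonpos_of_nonneg huT h2]
  -- at `z = 40 / θ ^ n` the decay beats every power of `2 ^ n`, hence of `z`
  have hprof := h.isDecayingProfile hθ hθ₁ (fun z hz => (hpos z hz).le) hle
  have hlim : Tendsto (fun n : ℕ => 80 ^ (N + 1) *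
      (((2 ^ n : ℕ) : ℝ) ^ (N + 1) * (1 / 2 : ℝ) ^ 2 ^ n)) atTop (𝓝 0) := by
    have h1 := tendsto_pow_const_mul_const_pow_of_abs_lt_one (N + 1)
      (show |(1 / 2 : ℝ)| < 1 by rw [abs_of_pos] <;> norm_num)
    have h2 := h1.comp (tendsto_pow_atTop_atTop_of_one_lt (one_lt_two : 1 < (2:ℕ)))
    simpa using h2.const_mul (80 ^ (N + 1))
  refine absurd (ge_of_tendsto hlim (Eventually.of_forall fun n => ?_)) (not_le.2 one_pos)
  set z := 40 / θ ^ n with hz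
  have hz40 : 40 ≤ z := by
    rw [hz, le_div_iff₀ (by positivity)]
    nlinarith [pow_le_one₀ hθ.le hθ₁.le (n := n)]
  have hz2 : z ≤ 40 * 2 ^ n := by
    rw [hz, div_le_iff₀ (by positivity), mul_assoc, ← mul_pow]
    have : 1 ≤ (2 * θ) ^ n := one_le_pow₀ (by linarith)
    linarith
  have h1 := hlow z (by linarith) fun y hy => hpos y hy.1
  have h2 := hprof.mul_le (by linarith) le_rfl n (le_refl z)
  have h3 := hpos z (by linarith)
  have h4 : 0 ≤ (2 * θ - 1) * z := mul_nonneg (by linarith) (by linarith)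
  have h5 : (1 + (2 * θ - 1) * z) ^ (N + 1) ≤ (80 * 2 ^ n) ^ (N + 1) := by
    gcongr
    nlinarith
  have h6 : u z ≤ (1 / 2) ^ 2 ^ n := by
    have h7 : θ ^ 2 * (1 / 2 : ℝ) ^ 2 ^ n ≤ 1 * (1 / 2) ^ 2 ^ n := by
      gcongr; exact pow_le_one₀ hθ.le hθ₁.le
    nlinarith
  calc (1:ℝ) ≤ u z * (1 + (2 * θ - 1) * z) ^ (N + 1) := h1
    _ ≤ (1 / 2) ^ 2 ^ n * (80 * 2 ^ n) ^ (N + 1) := by gcongr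
    _ = _ := by push_cast; ring

/-! ### Shooting in `θ` -/

/-- At a fixed point `z` the solution is jointly continuous in `(θ, δ)`. -/
lemma continuousOn_of_isClippedSolution {u : ℝ → ℝ → ℝ → ℝ}
    (hu : ∀ θ ∈ Set.Icc (0:ℝ) 1, ∀ δ ∈ Set.Icc (0:ℝ) 1, IsClippedSolution θ δ (u θ δ))
    {z : ℝ} (hz : 0 ≤ z) :
    ContinuousOn (fun p : ℝ × ℝ => u p.1 p.2 z) (Set.Icc 0 1 ×ˢ Set.Icc 0 1) := by
  set K : ℝ := Real.exp (16 * z) * (2 * z * (4 + 32 * z)) * 2 with hK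
  have hK0 : 0 ≤ K := by positivity
  refine (LipschitzOnWith.of_dist_le_mul (K := K.toNNReal) fun p hp q hq => ?_).continuousOn
  have h1 := (hu _ hp.1 _ hp.2).abs_sub_le_of_parameters (hu _ hq.1 _ hq.2) hp.1 hq.1.1 hp.2 hq.2
    hz le_rfl
  rw [Real.dist_eq, Real.coe_toNNReal K hK0, Prod.dist_eq, Real.dist_eq, Real.dist_eq]
  refine h1.trans ?_
  rw [hK, mul_assoc _ 2]
  gcongr
  linarith [le_max_left |p.1 - q.1| |p.2 - q.2|, le_max_right |p.1 - q.1| |p.2 - q.2|]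

/-- Shooting: for small `ε` there is a decaying profile with `θ` close to `1/2` and `δ = ε / θ ^ 2`.
The parameters without a downward exit and those without an upward exit are closed sets covering an
interval, and each contains one of its end points. -/
lemma exists_isDecayingProfile {η : ℝ} (hη : 0 < η) :
    ∃ ε₀ : ℝ, 0 < ε₀ ∧ ∀ ε, 0 < ε → ε < ε₀ →
      ∃ θ, 2 / 5 ≤ θ ∧ θ < 1 ∧ |θ - 1 / 2| ≤ η ∧ ∃ u, IsDecayingProfile θ (ε / θ ^ 2) u := by
  obtain ⟨η₀, hη₀, hη₀', hnear⟩ := exists_le_barrier_of_near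
  set ρ := min η η₀ with hρ
  have hρ0 : 0 < ρ := lt_min hη hη₀
  have hρη : ρ ≤ η := min_le_left _ _
  have hρη₀ : ρ ≤ η₀ := min_le_right _ _
  have hex : ∀ θ δ : ℝ, ∃ u, θ ∈ Set.Icc (0:ℝ) 1 → δ ∈ Set.Icc (0:ℝ) 1 →
      IsClippedSolution θ δ u := by
    intro θ δ
    by_cases h : θ ∈ Set.Icc (0:ℝ) 1 ∧ δ ∈ Set.Icc (0:ℝ) 1
    · obtain ⟨u, hu⟩ := exists_isClippedSolution h.1.1 h.1.2 h.2.1 h.2.2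
      exact ⟨u, fun _ _ => hu⟩
    · exact ⟨0, fun h1 h2 => absurd ⟨h1, h2⟩ h⟩
  choose u hu' using hex
  have hu : ∀ θ ∈ Set.Icc (0:ℝ) 1, ∀ δ ∈ Set.Icc (0:ℝ) 1, IsClippedSolution θ δ (u θ δ) :=
    fun θ h1 δ h2 => hu' θ δ h1 h2
  have hc := fun {z : ℝ} (hz : 0 ≤ z) => continuousOn_of_isClippedSolution hu hz
  have hI : ∀ θ ∈ Set.Icc (1 / 2 - ρ) (1 / 2 + ρ), 2 / 5 ≤ θ ∧ θ ≤ 3 / 5 ∧ |θ - 1 / 2| ≤ ρ ∧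
      θ ∈ Set.Icc (0:ℝ) 1 := by
    intro θ hθ
    have h1 := hθ.1
    have h2 := hθ.2
    refine ⟨by linarith, by linarith, abs_le.2 ⟨by linarith, by linarith⟩, by linarith,
      by linarith⟩
  have hl := hI (1 / 2 - ρ) ⟨le_rfl, by linarith⟩
  have hr := hI (1 / 2 + ρ) ⟨by linarith, le_rfl⟩
  have h00 : (0:ℝ) ∈ Set.Icc (0:ℝ) 1 := ⟨le_rfl, zero_le_one⟩
  obtain ⟨z₁, hz₁, hneg⟩ := (hu _ hl.2.2.2 0 h00).exists_neg_of_lt_half (by linarith) (by linarith)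
    (hnear _ 0 _ (hl.2.2.1.trans hρη₀) le_rfl hη₀.le (hu _ hl.2.2.2 0 h00))
  obtain ⟨z₂, hz₂, hgt⟩ := (hu _ hr.2.2.2 0 h00).exists_barrier_lt_of_half_lt (by linarith)
    (by linarith) (hnear _ 0 _ (hr.2.2.1.trans hρη₀) le_rfl hη₀.le (hu _ hr.2.2.2 0 h00))
  have hz₂0 : 0 ≤ z₂ := by linarith
  -- both sign conditions persist for small `δ`
  have hslice : ∀ θ ∈ Set.Icc (0:ℝ) 1, ∀ z, 0 ≤ z →
      ContinuousWithinAt (fun δ => u θ δ z) (Set.Icc 0 1) 0 := fun θ hθ z hz =>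
    ((hc hz).comp (f := fun δ : ℝ => (θ, δ)) (s := Set.Icc 0 1) (by fun_prop)
      fun δ hδ => ⟨hθ, hδ⟩) 0 h00
  have hev := ((hslice _ hl.2.2.2 z₁ hz₁).eventually_lt continuousWithinAt_const hneg).and
    (continuousWithinAt_const.eventually_lt (hslice _ hr.2.2.2 z₂ hz₂0) hgt)
  obtain ⟨r, hr0, hball⟩ := Metric.mem_nhdsWithin_iff.1 hev
  refine ⟨4 / 25 * min r (min η₀ 1), by positivity, fun ε hε hε₀ => ?_⟩
  have hδ : ∀ θ, 2 / 5 ≤ θ → 0 < ε / θ ^ 2 ∧ ε / θ ^ 2 < min r (min η₀ 1) := by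
    intro θ hθ
    have h1 : (2 / 5) ^ 2 ≤ θ ^ 2 := by gcongr
    have h2 : 0 < min r (min η₀ 1) := by positivity
    refine ⟨by positivity, ?_⟩
    rw [div_lt_iff₀ (by positivity)]
    nlinarith
  have hδI : ∀ θ, 2 / 5 ≤ θ → ε / θ ^ 2 ∈ Set.Icc (0:ℝ) 1 := fun θ hθ =>
    ⟨(hδ θ hθ).1.le, ((hδ θ hθ).2.le.trans (min_le_right _ _)).trans (min_le_right _ _)⟩
  have hδη : ∀ θ, 2 / 5 ≤ θ → ε / θ ^ 2 ≤ η₀ := fun θ hθ =>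
    ((hδ θ hθ).2.le.trans (min_le_right _ _)).trans (min_le_left _ _)
  have hδr : ∀ θ, 2 / 5 ≤ θ → ε / θ ^ 2 ∈ Metric.ball 0 r ∩ Set.Icc (0:ℝ) 1 := fun θ hθ => by
    refine ⟨?_, hδI θ hθ⟩
    rw [mem_ball_zero_iff, Real.norm_eq_abs, abs_of_pos (hδ θ hθ).1]
    exact (hδ θ hθ).2.trans_le (min_le_left _ _)
  have hsol : ∀ θ ∈ Set.Icc (1 / 2 - ρ) (1 / 2 + ρ),
      IsClippedSolution θ (ε / θ ^ 2) (u θ (ε / θ ^ 2)) := fun θ hθ =>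
    hu θ (hI θ hθ).2.2.2 _ (hδI θ (hI θ hθ).1)
  have hpath : ∀ z, 0 ≤ z →
      ContinuousOn (fun θ => u θ (ε / θ ^ 2) z) (Set.Icc (1 / 2 - ρ) (1 / 2 + ρ)) := by
    intro z hz
    refine (hc hz).comp (f := fun θ : ℝ => (θ, ε / θ ^ 2)) ?_ fun θ hθ =>
      ⟨(hI θ hθ).2.2.2, hδI θ (hI θ hθ).1⟩
    refine continuousOn_id.prodMk (continuousOn_const.div (by fun_prop) fun θ hθ => ?_)
    have := (hI θ hθ).1
    positivity
  have hlneg : u (1 / 2 - ρ) (ε / (1 / 2 - ρ) ^ 2) z₁ < 0 := (hball (hδr _ hl.1)).1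
  have hrgt : barrier z₂ < u (1 / 2 + ρ) (ε / (1 / 2 + ρ) ^ 2) z₂ := (hball (hδr _ hr.1)).2
  -- crossing zero and crossing the barrier exclude each other
  have hdisj : ∀ θ ∈ Set.Icc (1 / 2 - ρ) (1 / 2 + ρ), ∀ a b, 0 ≤ a → 40 ≤ b →
      u θ (ε / θ ^ 2) a < 0 → barrier b < u θ (ε / θ ^ 2) b → False := by
    intro θ hθ a b ha hb hua hub
    rcases le_total a b with hab | hab
    · linarith [(hsol θ hθ).neg_of_neg ha hua hab, barrier_pos b]
    · linarith [(hsol θ hθ).barrier_le_of_barrier_le (hI θ hθ).1 (hδ θ (hI θ hθ).1).1.le hb hub.le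
        hab, barrier_pos a]
  have hclosed : ∀ (S : Set ℝ) (P : ℝ → Set ℝ), (∀ z ∈ S, 0 ≤ z) → (∀ z, IsClosed (P z)) →
      IsClosed {θ | θ ∈ Set.Icc (1 / 2 - ρ) (1 / 2 + ρ) ∧ ∀ z ∈ S, u θ (ε / θ ^ 2) z ∈ P z} := by
    intro S P hS hP
    have h1 : {θ | θ ∈ Set.Icc (1 / 2 - ρ) (1 / 2 + ρ) ∧ ∀ z ∈ S, u θ (ε / θ ^ 2) z ∈ P z} =
        Set.Icc (1 / 2 - ρ) (1 / 2 + ρ) ∩ ⋂ z ∈ S, (Set.Icc (1 / 2 - ρ) (1 / 2 + ρ) ∩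
          (fun θ => u θ (ε / θ ^ 2) z) ⁻¹' P z) := by
      ext θ
      simp only [Set.mem_ofPred_eq, Set.mem_inter_iff, Set.mem_iInter, Set.mem_preimage]
      exact ⟨fun h => ⟨h.1, fun z hz => ⟨h.1, h.2 z hz⟩⟩, fun h => ⟨h.1, fun z hz => (h.2 z hz).2⟩⟩
    rw [h1]
    exact isClosed_Icc.inter (isClosed_biInter fun z hz =>
      (hpath z (hS z hz)).preimage_isClosed_of_isClosed isClosed_Icc (hP z))
  obtain ⟨θ, hθ, ⟨-, hnn⟩, ⟨-, hle⟩⟩ := isPreconnected_closed_iff.1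
    (isPreconnected_Icc (a := 1 / 2 - ρ) (b := 1 / 2 + ρ)) _ _
    (hclosed (Set.Ici 0) (fun _ => Set.Ici 0) (fun z hz => hz) fun _ => isClosed_Ici)
    (hclosed (Set.Ici 40) (fun z => Set.Iic (barrier z))
      (fun z hz => (by norm_num : (0:ℝ) ≤ 40).trans hz) fun _ => isClosed_Iic)
    (fun θ hθ => by
      by_contra hcon
      rw [Set.mem_union, not_or] at hcon
      obtain ⟨hA, hB⟩ := hcon
      simp only [Set.mem_ofPred_eq, not_and, not_forall, Set.mem_Ici, Set.mem_Iic, not_le] at hA hB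
      obtain ⟨a, ha, hua⟩ := hA hθ
      obtain ⟨b, hb, hub⟩ := hB hθ
      exact hdisj θ hθ a b ha hb hua hub)
    (by
      have hm : 1 / 2 + ρ ∈ Set.Icc (1 / 2 - ρ) (1 / 2 + ρ) := ⟨by linarith, le_rfl⟩
      refine ⟨1 / 2 + ρ, hm, hm, fun z hz => ?_⟩
      by_contra hcon
      exact hdisj _ hm z z₂ hz hz₂ (not_le.1 hcon) hrgt)
    (by
      have hm : 1 / 2 - ρ ∈ Set.Icc (1 / 2 - ρ) (1 / 2 + ρ) := ⟨le_rfl, by linarith⟩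
      refine ⟨1 / 2 - ρ, hm, hm, fun z hz => ?_⟩
      by_contra hcon
      exact hdisj _ hm z₁ z hz₁ hz hlneg (not_le.1 hcon))
  obtain ⟨h1, h2, h3, -⟩ := hI θ hθ
  refine ⟨θ, h1, by linarith, h3.trans hρη, u θ (ε / θ ^ 2),
    (hsol θ hθ).isDecayingProfile (by linarith) (by linarith) hnn fun z hz => ?_⟩
  rcases le_total z 40 with hz40 | hz40
  · exact hnear θ _ _ (h3.trans hρη₀) (hδ θ h1).1.le (hδη θ h1) (hsol θ hθ) z hz hz40
  · exact hle z hz40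

/-! ### Return to the self-similar problem -/

/-- The exponent `b` with `2 ^ (-1 / b) = θ`, for `0 < θ < 1`. -/
noncomputable def exponentOfRatio (θ : ℝ) : ℝ := Real.log 2 / -Real.log θ

lemma exponentOfRatio_pos {θ : ℝ} (h₀ : 0 < θ) (h₁ : θ < 1) : 0 < exponentOfRatio θ :=
  div_pos (Real.log_pos one_lt_two) (neg_pos.2 (Real.log_neg h₀ h₁))

lemma two_rpow_inv_exponentOfRatio {θ : ℝ} (h₀ : 0 < θ) :
    (2 : ℝ) ^ (1 / exponentOfRatio θ) = θ⁻¹ := by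
  have h2 : Real.log 2 ≠ 0 := (Real.log_pos one_lt_two).ne'
  rw [Real.rpow_def_of_pos two_pos, exponentOfRatio, one_div_div, mul_div_cancel₀ _ h2,
    Real.exp_neg, Real.exp_log h₀]

lemma tendsto_exponentOfRatio : Tendsto exponentOfRatio (𝓝 (1 / 2)) (𝓝 1) := by
  have hl : Real.log (1 / 2) = -Real.log 2 := by rw [one_div, Real.log_inv]
  have h2 := Real.log_pos one_lt_two
  have h : ContinuousAt exponentOfRatio (1 / 2) := by
    unfold exponentOfRatio
    exact continuousAt_const.div (Real.continuousAt_log (by norm_num)).neg (by rw [hl]; linarith)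
  have h1 : exponentOfRatio (1 / 2) = 1 := by
    rw [exponentOfRatio, hl, neg_neg, div_self h2.ne']
  have h3 := h.tendsto
  rwa [h1] at h3

/-- The change of variables `Φ(x) = y u(k y)`, `y = x ^ (1 / b)`, `k = 2 ^ (γ - 1) θ ^ 2`. -/
lemma IsDecayingProfile.exists_selfSimilarProfile {γ θ δ : ℝ} {u : ℝ → ℝ}
    (h : IsDecayingProfile θ δ u) (hθ₀ : 2 / 5 ≤ θ) (hθ₁ : θ < 1)
    (hδ : δ = 2 ^ (1 - γ) / θ ^ 2) :
    ∃ Φ : ℝ → ℝ, IsSelfSimilarProfile γ (exponentOfRatio θ) Φ ∧ (∀ x : ℝ, 0 < x → 0 < Φ x) ∧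
      HasExponentialDecay Φ := by
  have hθ : 0 < θ := by linarith
  set b := exponentOfRatio θ with hb
  have hb0 : 0 < b := exponentOfRatio_pos hθ hθ₁
  have h2b : (2 : ℝ) ^ (1 / b) = θ⁻¹ := two_rpow_inv_exponentOfRatio hθ
  have hγ : (2 : ℝ) ^ (γ - 1) * (2 : ℝ) ^ (1 - γ) = 1 := by
    rw [← Real.rpow_add two_pos]; simp
  set g := (2 : ℝ) ^ (γ - 1) with hg
  have hg0 : 0 < g := by positivity
  set k := g * θ ^ 2 with hk
  have hk0 : 0 < k := by positivity
  have hkδ : k * δ = 1 := by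
    rw [hδ, hk]; field_simp; exact hγ
  have hδ0 : 0 ≤ δ := by rw [hδ]; positivity
  have hderiv : ∀ x, 0 < x → HasDerivAt (fun x : ℝ => x ^ (1 / b) * u (k * x ^ (1 / b)))
      ((1 / b * x ^ (1 / b - 1)) * u (k * x ^ (1 / b)) + x ^ (1 / b) *
        ((δ * u (k * x ^ (1 / b)) ^ 2 - u (θ * (k * x ^ (1 / b))) ^ 2) *
          (k * (1 / b * x ^ (1 / b - 1))))) x := by
    intro x hx
    have h1 : HasDerivAt (fun x : ℝ => x ^ (1 / b)) (1 / b * x ^ (1 / b - 1)) x :=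
      Real.hasDerivAt_rpow_const (Or.inl hx.ne')
    have h2 : 0 ≤ k * x ^ (1 / b) := by positivity
    exact h1.mul ((h.hasDerivAt _ h2).comp x (h1.const_mul k))
  have hpos : ∀ x, 0 < x → 0 < x ^ (1 / b) * u (k * x ^ (1 / b)) := fun x hx =>
    mul_pos (by positivity) (h.pos _ (by positivity))
  refine ⟨fun x => x ^ (1 / b) * u (k * x ^ (1 / b)), ⟨fun x hx => (hderiv x hx).differentiableAt,
    fun x hx => ?_, ?_⟩, hpos, ?_⟩
  · have hhalf : (x / 2) ^ (1 / b) = θ * x ^ (1 / b) := by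
      rw [Real.div_rpow hx.le two_pos.le, h2b, div_inv_eq_mul, mul_comm]
    have hx1 : x * x ^ (1 / b - 1) = x ^ (1 / b) := by
      rw [Real.rpow_sub_one hx.ne']; field_simp
    rw [(hderiv x hx).deriv]
    simp only [hhalf]
    have hcomm : k * (θ * x ^ (1 / b)) = θ * (k * x ^ (1 / b)) := by ring
    rw [hcomm]
    set y := x ^ (1 / b) with hy
    set U := u (k * y)
    set V := u (θ * (k * y))
    have e1 : b * x * (1 / b * x ^ (1 / b - 1) * U +
        y * ((δ * U ^ 2 - V ^ 2) * (k * (1 / b * x ^ (1 / b - 1))))) =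
        (x * x ^ (1 / b - 1)) * (U + y * (k * δ * U ^ 2 - k * V ^ 2)) := by
      field_simp
    rw [e1, hx1, hkδ, hk]
    ring
  · refine (isEquivalent_iff_exists_eq_mul).2 ⟨fun x => u (k * x ^ (1 / b)), ?_, ?_⟩
    · have h1 : Tendsto (fun x : ℝ => k * x ^ (1 / b)) (𝓝[>] 0) (𝓝 0) := by
        have h2 : ContinuousAt (fun x : ℝ => k * x ^ (1 / b)) 0 :=
          (Real.continuousAt_rpow_const 0 (1 / b) (Or.inr (by positivity))).const_mul k
        have h3 := h2.tendsto
        rw [Real.zero_rpow (by positivity), mul_zero] at h3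
        exact h3.mono_left nhdsWithin_le_nhds
      have h4 := (h.hasDerivAt 0 le_rfl).continuousAt.tendsto
      rw [h.zero] at h4
      exact h4.comp h1
    · exact Eventually.of_forall fun x => mul_comm _ _
  · -- `x ≥ 2 ^ n * X` corresponds to `k * x ^ (1 / b) ≥ 40 / θ ^ n`
    set X := (40 / k) ^ b with hX
    have hX0 : 0 < X := by positivity
    have hl2 := Real.log_pos one_lt_two
    refine ⟨1 / k, Real.log 2 / (2 * X), by positivity, by positivity, ?_⟩
    filter_upwards [eventually_ge_atTop X] with x hx
    have hx0 : 0 < x := hX0.trans_le hx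
    rw [abs_of_pos (hpos x hx0)]
    obtain ⟨n, hn1, hn2⟩ := exists_nat_pow_near ((one_le_div hX0).2 hx) one_lt_two
    set z := k * x ^ (1 / b) with hz
    have hzn : 40 / θ ^ n ≤ z := by
      have h1 : (2 ^ n * X) ^ (1 / b) ≤ x ^ (1 / b) := by
        have := (le_div_iff₀ hX0).1 hn1
        gcongr
      have h3 : ((2:ℝ) ^ n * X) ^ (1 / b) = (θ⁻¹) ^ n * (40 / k) := by
        rw [Real.mul_rpow (by positivity) hX0.le, hX, ← Real.rpow_mul (by positivity),
          mul_one_div_cancel hb0.ne', Real.rpow_one, ← h2b, ← Real.rpow_natCast,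
          ← Real.rpow_natCast, ← Real.rpow_mul two_pos.le, ← Real.rpow_mul two_pos.le,
          mul_comm (n : ℝ)]
      rw [h3] at h1
      calc 40 / θ ^ n = k * ((θ⁻¹) ^ n * (40 / k)) := by rw [inv_pow]; field_simp
        _ ≤ z := by rw [hz]; gcongr
    have h4 := h.mul_le hθ₀ hδ0 n hzn
    have h5 : θ ^ 2 * (1 / 2 : ℝ) ^ 2 ^ n ≤ 1 * (1 / 2) ^ 2 ^ n := by
      gcongr; exact pow_le_one₀ hθ.le hθ₁.le
    have h6 : (1 / 2 : ℝ) ^ 2 ^ n ≤ Real.exp (-(Real.log 2 / (2 * X)) * x) := by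
      have h7 : (1 / 2 : ℝ) ^ 2 ^ n = Real.exp (-(Real.log 2 * 2 ^ n)) := by
        rw [Real.exp_neg, Real.exp_mul, Real.exp_log two_pos, one_div, inv_pow,
          ← Real.rpow_natCast]
        push_cast
        rfl
      rw [h7, Real.exp_le_exp]
      have h8 : x / X < 2 * 2 ^ n := by rw [← pow_succ']; exact hn2
      have h9 : Real.log 2 / (2 * X) * x = Real.log 2 * (x / X / 2) := by field_simp
      have h10 : Real.log 2 * (x / X / 2) ≤ Real.log 2 * 2 ^ n := by gcongr; linarith
      linarith
    calc x ^ (1 / b) * u z = 1 / k * (z * u z) := by rw [hz]; field_simp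
      _ ≤ 1 / k * Real.exp (-(Real.log 2 / (2 * X)) * x) := by gcongr; linarith

lemma eventually_exists_selfSimilarProfile {η : ℝ} (hη : 0 < η) :
    ∀ᶠ γ : ℝ in atTop, ∃ b : ℝ, |b - 1| < η ∧ 0 < b ∧
      ∃ Φ : ℝ → ℝ, IsSelfSimilarProfile γ b Φ ∧ (∀ x : ℝ, 0 < x → 0 < Φ x) ∧
        HasExponentialDecay Φ := by
  obtain ⟨r, hr, hb⟩ := Metric.tendsto_nhds_nhds.1 tendsto_exponentOfRatio η hη
  obtain ⟨ε₀, hε₀, hex⟩ := exists_isDecayingProfile (half_pos hr)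
  have hlim : Tendsto (fun γ : ℝ => (2:ℝ) ^ (1 - γ)) atTop (𝓝 0) := by
    have h1 := (tendsto_rpow_atTop_of_base_lt_one (1 / 2) (by norm_num) (by norm_num)).const_mul
      2
    rw [mul_zero] at h1
    refine h1.congr fun γ => ?_
    rw [Real.rpow_sub two_pos, Real.rpow_one, one_div, Real.inv_rpow two_pos.le, div_eq_mul_inv]
  filter_upwards [hlim.eventually_lt_const hε₀] with γ hγ
  obtain ⟨θ, hθ₀, hθ₁, hθ, u, hu⟩ := hex _ (by positivity) hγ
  refine ⟨exponentOfRatio θ, ?_, exponentOfRatio_pos (by linarith) hθ₁,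
    hu.exists_selfSimilarProfile hθ₀ hθ₁ rfl⟩
  rw [← Real.dist_eq]
  exact hb (by rw [Real.dist_eq]; linarith)

theorem theorem5p1 :
    ∃ γ₀ : ℝ, 1 < γ₀ ∧ ∃ b : ℝ → ℝ,
      (∀ γ : ℝ, γ₀ < γ → 0 < b γ ∧
        ∃ Φ : ℝ → ℝ, IsSelfSimilarProfile γ (b γ) Φ ∧ (∀ x : ℝ, 0 < x → 0 < Φ x) ∧
          HasExponentialDecay Φ) ∧
      Tendsto b atTop (𝓝 1) := by
  set S : ℝ → Set ℝ := fun γ => {b | 0 < b ∧ ∃ Φ : ℝ → ℝ, IsSelfSimilarProfile γ b Φ ∧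
    (∀ x : ℝ, 0 < x → 0 < Φ x) ∧ HasExponentialDecay Φ} with hS
  have hev : ∀ η : ℝ, 0 < η → ∀ᶠ γ : ℝ in atTop, ∃ b ∈ S γ, |b - 1| < η := fun η hη => by
    filter_upwards [eventually_exists_selfSimilarProfile hη] with γ ⟨b, h1, h2⟩
    exact ⟨b, h2, h1⟩
  -- choose an almost closest admissible exponent to `1`
  have hchoose : ∀ γ, ∃ b, 0 < γ → (S γ).Nonempty →
      b ∈ S γ ∧ dist 1 b < Metric.infDist 1 (S γ) + 1 / γ := by
    intro γ
    by_cases h : 0 < γ ∧ (S γ).Nonempty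
    · obtain ⟨b, hb⟩ := (Metric.infDist_lt_iff h.2).1
        (lt_add_of_pos_right (Metric.infDist 1 (S γ)) (one_div_pos.2 h.1))
      exact ⟨b, fun _ _ => hb⟩
    · exact ⟨0, fun h1 h2 => absurd ⟨h1, h2⟩ h⟩
  choose b hb using hchoose
  obtain ⟨γ₁, hγ₁⟩ := eventually_atTop.1 (hev 1 one_pos)
  refine ⟨max γ₁ 2, by simp, b, fun γ hγ => ?_, ?_⟩
  · obtain ⟨b', hb', -⟩ := hγ₁ γ ((le_max_left _ _).trans hγ.le)
    exact (hb γ (by linarith [le_max_right γ₁ 2]) ⟨b', hb'⟩).1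
  · refine Metric.tendsto_atTop'.2 fun η hη => ?_
    have hinv : ∀ᶠ γ : ℝ in atTop, 1 / γ < η / 2 := by
      simpa using (tendsto_inv_atTop_zero (𝕜 := ℝ)).eventually_lt_const (half_pos hη)
    obtain ⟨N, hN⟩ := eventually_atTop.1
      ((hev (η / 2) (half_pos hη)).and (hinv.and (eventually_gt_atTop 0)))
    refine ⟨N, fun γ hγ => ?_⟩
    obtain ⟨⟨b', hb', hb'1⟩, h1, h2⟩ := hN γ hγ.le
    have h3 := (hb γ h2 ⟨b', hb'⟩).2
    have h4 := Metric.infDist_le_dist_of_mem (x := 1) hb'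
    rw [dist_comm 1 b', Real.dist_eq] at h4
    rw [dist_comm]
    linarith
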